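/- Let $d\ge 1$, $0<H<1$, and let $B^H=\{B^H_t,\ t\ge 0\}$ be a $d$-dimensional fractional Brownian motion with Hurst parameter $H$, i.e. a jointly measurable, $\mathbb R^d$-valued centered Gaussian process with independent components, each having covariance $\frac12\left[t^{2H}+s^{2H}-|t-s|^{2H}\right]$. Let $k=(k_1,\dots,k_d)$ be a multi-index of nonnegative integers, $|k|=k_1+\cdots+k_d$, and let $\#$ be the number of indices $i\in\{1,\dots,d\}$ for which $k_i$ is odd. For $\varepsilon>0$ and $x\in\mathbb R^d$ let $$f^{(k)}_\varepsilon(x)=\frac{i^{|k|}}{(2\pi)^d}\int_{\mathbb R^d}p_1^{k_1}\cdots p_d^{k_d}\,e^{i\langle p,x\rangle}e^{-\varepsilon|p|^2/2}\,dp$$ (the $k$-th partial derivative of the centered Gaussian density with covariance $\varepsilon I_d$), and for $t\ge 0$ and $y\in\mathbb R^d$ let $$\widehat\alpha^{(k)}_{t,\varepsilon}(y)=(-1)^{|k|}\int_{\{0<r<s<t\}}f^{(k)}_\varepsilon(B^H_s-B^H_r-y)\,dr\,ds .$$ If $$H<\min\left\{\frac{2}{2|k|+d},\ \frac{1}{|k|+d-\#},\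 \frac1d\right\},$$ then $\widehat\alpha^{(k)}_{t}(0)$, the $k$-th order derivative of the self-intersection local time of $B^H$ at $0$, exists in $L^2$: for every $\varepsilon>0$ the integral defining $\widehat\alpha^{(k)}_{t,\varepsilon}(0)$ converges absolutely almost surely and $\widehat\alpha^{(k)}_{t,\varepsilon}(0)\in L^2$, and there is a real random variable $\widehat\alpha^{(k)}_t(0)\in L^2$ such that $\widehat\alpha^{(k)}_{t,\varepsilon}(0)\to\widehat\alpha^{(k)}_t(0)$ in $L^2$ as $\varepsilon\to0^+$. -/

import Mathlib

open MeasureTheory ProbabilityTheory Filter Topology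
open scoped NNReal ENNReal

/-- `B` is a `d`-dimensional fractional Brownian motion with Hurst parameter `H` under `P`: a centered
Gaussian process indexed by `[0, ∞)`, whose coordinates are independent (for a Gaussian process:
uncorrelated) and have covariance `(t ^ (2H) + s ^ (2H) - |t - s| ^ (2H)) / 2`. -/
structure IsFractionalBrownianMotion {Ω : Type*} [MeasurableSpace Ω] {d : ℕ} (H : ℝ)
    (B : ℝ≥0 → Ω → EuclideanSpace ℝ (Fin d)) (P : Measure Ω) : Prop where
  isGaussianProcess : IsGaussianProcess B P
  centered : ∀ (t : ℝ≥0) (i : Fin d), ∫ ω, B t ω i ∂P = 0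
  covariance_eq : ∀ (t s : ℝ≥0) (i j : Fin d),
    covariance (fun ω => B t ω i) (fun ω => B s ω j) P =
      if i = j then
        (1 / 2 : ℝ) *
          ((t : ℝ) ^ (2 * H) + (s : ℝ) ^ (2 * H) - |(t : ℝ) - (s : ℝ)| ^ (2 * H))
      else 0

/-- The order `|k| = k₁ + ⋯ + k_d` of a multi-index. -/
def multiOrder {d : ℕ} (k : Fin d → ℕ) : ℕ := ∑ i, k i

/-- The number of indices `i` for which `k i` is odd. -/
def oddCount {d : ℕ} (k : Fin d → ℕ) : ℕ := (Finset.univ.filter (fun i => Odd (k i))).card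

/-- The `k`-th partial derivative of the centered Gaussian density with covariance matrix `ε • 1`,
written through its Fourier transform:
`i ^ |k| / (2π) ^ d * ∫ p₁ ^ k₁ ⋯ p_d ^ k_d * exp (i ⟨p, x⟩) * exp (-ε |p|² / 2) dp`. -/
noncomputable def gaussianKernelDeriv {d : ℕ} (k : Fin d → ℕ) (ε : ℝ)
    (x : EuclideanSpace ℝ (Fin d)) : ℂ :=
  Complex.I ^ multiOrder k / ((2 * Real.pi : ℝ) : ℂ) ^ d *
    ∫ p : EuclideanSpace ℝ (Fin d),
      (∏ i, ((p i : ℝ) : ℂ) ^ k i) *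
        Complex.exp (Complex.I * ((inner ℝ p x : ℝ) : ℂ)) *
        Complex.exp (((-ε * ‖p‖ ^ 2 / 2 : ℝ)) : ℂ)

/-- The set `D = {(r, s) : 0 < r < s < t}`. -/
def timeSimplex (t : ℝ) : Set (ℝ × ℝ) := {q | 0 < q.1 ∧ q.1 < q.2 ∧ q.2 < t}

/-- The integrand `f_ε^{(k)} (B_s - B_r - y)` at `q = (r, s)`; it is only used for `q` in
`timeSimplex t`, where both times are positive and `Real.toNNReal` does not change them. -/
noncomputable def dsltIntegrand {Ω : Type*} {d : ℕ} (B : ℝ≥0 → Ω → EuclideanSpace ℝ (Fin d))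
    (k : Fin d → ℕ) (ε : ℝ) (y : EuclideanSpace ℝ (Fin d)) (ω : Ω) (q : ℝ × ℝ) : ℂ :=
  gaussianKernelDeriv k ε (B q.2.toNNReal ω - B q.1.toNNReal ω - y)

/-- The approximation at level `ε` of the `k`-th derivative of the self-intersection local time:
`(-1) ^ |k| * ∫_D f_ε^{(k)} (B_s - B_r - y) dr ds`. -/
noncomputable def dsltApprox {Ω : Type*} {d : ℕ} (B : ℝ≥0 → Ω → EuclideanSpace ℝ (Fin d))
    (k : Fin d → ℕ) (t : ℝ) (ε : ℝ) (y : EuclideanSpace ℝ (Fin d)) (ω : Ω) : ℂ :=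
  (-1) ^ multiOrder k * ∫ q in timeSimplex t, dsltIntegrand B k ε y ω q

/-!
# Derivatives of the self-intersection local time of fractional Brownian motion

The second moments `E[α_ε α_η]` of the approximations are integrals over pairs of time intervals
`[r, s]`, `[u, v]`.  Let `λ`, `ρ` be the variances of the increments of one coordinate over the
two intervals, `μ` their covariance and `Δ = λ ρ - μ²`.  Since the kernels are Fourier integrals,
the characteristic function of the increments and Fubini's theorem turn the integrand into a
constant times a product over the coordinates of integrals
`∫∫ x ^ k * y ^ k * exp (-((λ + ε) x² + 2 μ x y + (ρ + η) y²) / 2) dx dy`.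
Completing the square shows that each is a finite sum of terms `μ ^ j * Δ' ^ (-(k + j + 1) / 2)`
with `j ≤ k` and `j ≡ k mod 2`, where `Δ' = (λ + ε) (ρ + η) - μ² ≥ Δ`
(`integral_mixed_gaussian`).  So the integrand converges as `ε, η → 0`, and with `n` the number of
odd `k_i` it is dominated, uniformly in `ε` and `η`, by a multiple of
`|μ| ^ n * (λ ρ) ^ ((|k| - n) / 2) * Δ ^ (-(|k| + d / 2))` (`abs_incrementMoment_le`).
Once this function is known to be integrable, dominated convergence makes `E[α_ε α_η]` converge as
`ε` and `η` tend to `0` independently, which gives the Cauchy property in `L²`.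

Integrability rests on local nondeterminism: the earliest or latest of the four times keeps a
variance of order `h ^ (2 * H)` given the others, where `h` is its distance to them.  It is read
off the Mandelbrot–van Ness representation, because on the last `h` units of time only the kernel
of the latest time is nonzero (`lndConst_mul_le_gramDet`).  This bounds `Δ` below in each ordering
of the times, with successive gaps `a`, `b`, `c`:
* overlapping intervals: the dominating function is at most a multiple of
  `(a c) ^ (-H (|k| + d / 2)) * b ^ (-H d)`;
* nested intervals: `|μ|` is at most of order `b ^ min (2 H) 1`, and `b` gets an exponent above
  `-1` by `H < 1 / (|k| + d - n)` when `H ≤ 1 / 2`, while `H > 1 / 2` is only possible for `d = 1`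
  and `|k| ≤ 1`;
* disjoint intervals: `|μ| ≤ (a c) ^ H` is interpolated with the decay
  `|μ| ≤ a c b ^ (2 H - 2)`.

All exponents exceed `-1`, so the products of powers of the gaps are integrable
(`integrableOn_gramMajorant`).
-/

/-! ### The Mandelbrot–van Ness kernel and local nondeterminism -/

/-- The Mandelbrot–van Ness kernel `(t - u)₊ ^ (H - 1/2)`.  The case distinction makes it vanish
for `u ≥ t` also when `H = 1/2`, where `0 ^ 0 = 1` would spoil the formula with the
positive part. -/
noncomputable def mvnKernel (H t u : ℝ) : ℝ := if u < t then (t - u) ^ (H - 1 / 2) else 0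

lemma measurable_mvnKernel (H t : ℝ) : Measurable (mvnKernel H t) := by
  unfold mvnKernel
  exact Measurable.ite measurableSet_Iio (by fun_prop) measurable_const

/-- Self-similarity and translation invariance of the kernel. -/
lemma mvnKernel_affine {h : ℝ} (hh : 0 < h) (H s t v : ℝ) :
    mvnKernel H (s + h * t) (s + h * v) = h ^ (H - 1 / 2) * mvnKernel H t v := by
  unfold mvnKernel
  by_cases hv : v < t
  · have h1 : s + h * v < s + h * t := by nlinarith
    rw [if_pos hv, if_pos h1, ← Real.mul_rpow hh.le (by linarith)]
    congr 1; ring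
  · have h1 : ¬ s + h * v < s + h * t := by
      push Not at hv ⊢; nlinarith
    rw [if_neg hv, if_neg h1, mul_zero]

lemma abs_rpow_add_one_sub_rpow_le {w γ : ℝ} (hw : 0 < w) (h0 : -1 ≤ γ) (h1 : γ ≤ 1) :
    |(1 + w) ^ γ - w ^ γ| ≤ w ^ (γ - 1) := by
  have hder : ∀ x ∈ Set.Ioo w (1 + w), HasDerivAt (fun x : ℝ => x ^ γ) (γ * x ^ (γ - 1)) x :=
    fun x hx => Real.hasDerivAt_rpow_const (Or.inl (by have := hx.1; linarith))
  obtain ⟨c, hc, hc'⟩ := exists_hasDerivAt_eq_slope (fun x : ℝ => x ^ γ) (fun x => γ * x ^ (γ - 1))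
    (show w < 1 + w by linarith)
    (fun x hx => (Real.continuousAt_rpow_const _ _
      (Or.inl (by have := hx.1; linarith))).continuousWithinAt) hder
  have e : (1 + w) ^ γ - w ^ γ = γ * c ^ (γ - 1) := by
    rw [hc']; simp
  have hcpos : 0 < c := hw.trans hc.1
  rw [e, abs_mul, abs_of_pos (Real.rpow_pos_of_pos hcpos _)]
  calc |γ| * c ^ (γ - 1) ≤ 1 * c ^ (γ - 1) :=
        mul_le_mul_of_nonneg_right (abs_le.2 ⟨h0, h1⟩) (Real.rpow_nonneg hcpos.le _)
    _ ≤ w ^ (γ - 1) := by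
        rw [one_mul]
        exact Real.rpow_le_rpow_of_nonpos hw hc.1.le (by linarith)

lemma abs_rpow_add_one_sub_rpow_le' {w γ : ℝ} (hw : 0 < w) (h1 : γ ≤ 1) :
    |(1 + w) ^ γ - w ^ γ| ≤ 1 + w ^ γ := by
  have hwγ := Real.rpow_nonneg hw.le γ
  have h2 := Real.rpow_nonneg (show 0 ≤ 1 + w by linarith) γ
  rcases le_total 0 γ with h0 | h0
  · have h3 : (1 + w) ^ γ ≤ 1 ^ γ + w ^ γ := Real.rpow_add_le_add_rpow (by norm_num) hw.le h0 h1
    rw [Real.one_rpow] at h3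
    rw [abs_le]; constructor <;> linarith
  · have h3 : (1 + w) ^ γ ≤ w ^ γ := Real.rpow_le_rpow_of_nonpos hw (by linarith) h0
    rw [abs_le]; constructor <;> linarith

lemma integrable_sq_mvnKernel_one_sub_zero {H : ℝ} (h0 : 0 < H) (h1 : H < 1) :
    Integrable (fun u => (mvnKernel H 1 u - mvnKernel H 0 u) ^ 2) := by
  have hm : Measurable (fun u => (mvnKernel H 1 u - mvnKernel H 0 u) ^ 2) :=
    ((measurable_mvnKernel H 1).sub (measurable_mvnKernel H 0)).pow_const 2
  suffices hs : Integrable (fun w => (mvnKernel H 1 (-w) - mvnKernel H 0 (-w)) ^ 2) by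
    simpa using hs.comp_neg
  have hm' : Measurable (fun w => (mvnKernel H 1 (-w) - mvnKernel H 0 (-w)) ^ 2) :=
    hm.comp measurable_neg
  have sq : ∀ x : ℝ, 0 < x → (x ^ (H - 1 / 2)) ^ 2 = x ^ (2 * H - 1) := fun x hx => by
    rw [← Real.rpow_natCast, ← Real.rpow_mul hx.le]; congr 1; push_cast; ring
  have A1 : IntegrableOn (fun w => (mvnKernel H 1 (-w) - mvnKernel H 0 (-w)) ^ 2)
      (Set.Iic (-1)) := by
    refine (integrableOn_congr_fun (g := fun _ => (0 : ℝ)) ?_ measurableSet_Iic).2 integrableOn_zero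
    intro w (hw : w ≤ -1)
    simp only [mvnKernel]
    rw [if_neg (by linarith), if_neg (by linarith)]; norm_num
  have A2 : IntegrableOn (fun w => (mvnKernel H 1 (-w) - mvnKernel H 0 (-w)) ^ 2)
      (Set.Ioc (-1) 0) := by
    have hi : IntervalIntegrable (fun x : ℝ => (1 + x) ^ (2 * H - 1)) volume (-1) 0 := by
      have := (intervalIntegral.intervalIntegrable_rpow' (r := 2 * H - 1) (by linarith)
        (a := 0) (b := 1)).comp_add_left 1
      simpa using this
    rw [intervalIntegrable_iff_integrableOn_Ioc_of_le (by norm_num)] at hi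
    refine (integrableOn_congr_fun ?_ measurableSet_Ioc).2 hi
    intro w hw
    have h1 := hw.1
    have h2 := hw.2
    simp only [mvnKernel]
    rw [if_pos (by linarith), if_neg (by linarith), sub_zero, sq _ (by linarith)]
    congr 1; ring
  have key : ∀ w : ℝ, 0 < w → mvnKernel H 1 (-w) - mvnKernel H 0 (-w)
      = (1 + w) ^ (H - 1 / 2) - w ^ (H - 1 / 2) := by
    intro w hw
    simp only [mvnKernel]
    rw [if_pos (by linarith), if_pos (by linarith)]
    simp
  have A3 : IntegrableOn (fun w => (mvnKernel H 1 (-w) - mvnKernel H 0 (-w)) ^ 2)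
      (Set.Ioc 0 1) := by
    have hi := (intervalIntegral.intervalIntegrable_rpow' (r := 2 * H - 1) (by linarith)
        (a := 0) (b := 1))
    rw [intervalIntegrable_iff_integrableOn_Ioc_of_le (by norm_num)] at hi
    have hc : IntegrableOn (fun _ : ℝ => (2 : ℝ)) (Set.Ioc 0 1) := by
      simp
    refine (hc.add (hi.const_mul 2)).mono' hm'.aestronglyMeasurable ?_
    filter_upwards [ae_restrict_mem measurableSet_Ioc] with w hw
    rw [key w hw.1, Real.norm_eq_abs, abs_of_nonneg (sq_nonneg _), ← sq_abs]
    have h3 := abs_rpow_add_one_sub_rpow_le' (γ := H - 1 / 2) hw.1 (by linarith)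
    have h4 := sq w hw.1
    simp only [Pi.add_apply]
    rw [← h4]
    nlinarith [abs_nonneg ((1 + w) ^ (H - 1 / 2) - w ^ (H - 1 / 2)),
      sq_nonneg (1 - w ^ (H - 1 / 2))]
  have A4 : IntegrableOn (fun w => (mvnKernel H 1 (-w) - mvnKernel H 0 (-w)) ^ 2)
      (Set.Ioi 1) := by
    have hi := integrableOn_Ioi_rpow_of_lt (a := 2 * H - 3) (by linarith) (c := 1) (by norm_num)
    refine hi.mono' hm'.aestronglyMeasurable ?_
    filter_upwards [ae_restrict_mem measurableSet_Ioi] with w (hw : 1 < w)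
    have hw0 : 0 < w := by linarith
    rw [key w hw0, Real.norm_eq_abs, abs_of_nonneg (sq_nonneg _), ← sq_abs]
    have h3 := abs_rpow_add_one_sub_rpow_le (γ := H - 1 / 2) hw0 (by linarith) (by linarith)
    calc _ ≤ (w ^ (H - 1 / 2 - 1)) ^ 2 := pow_le_pow_left₀ (abs_nonneg _) h3 2
      _ = _ := by rw [← Real.rpow_natCast, ← Real.rpow_mul hw0.le]; congr 1; push_cast; ring
  have := ((A1.union A2).union A3).union A4
  rwa [Set.Iic_union_Ioc_eq_Iic (by norm_num), Set.Iic_union_Ioc_eq_Iic (by norm_num),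
    Set.Iic_union_Ioi, integrableOn_univ] at this

/-- The squared `L²` norm of `mvnKernel H 1 - mvnKernel H 0`, which normalises fractional Brownian
motion. -/
noncomputable def mvnConst (H : ℝ) : ℝ := ∫ u, (mvnKernel H 1 u - mvnKernel H 0 u) ^ 2

lemma sq_mvnKernel_sub_comp_affine {H s t : ℝ} (hst : s < t) (v : ℝ) :
    (mvnKernel H t (s + (t - s) * v) - mvnKernel H s (s + (t - s) * v)) ^ 2
      = (t - s) ^ (2 * H - 1) * (mvnKernel H 1 v - mvnKernel H 0 v) ^ 2 := by
  have hh : 0 < t - s := by linarith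
  have e1 := mvnKernel_affine hh H s 1 v
  have e2 := mvnKernel_affine hh H s 0 v
  rw [mul_one, add_sub_cancel] at e1
  rw [mul_zero, add_zero] at e2
  rw [e1, e2, ← mul_sub, mul_pow, ← Real.rpow_natCast, ← Real.rpow_mul hh.le]
  congr 2; push_cast; ring

lemma integrable_sq_mvnKernel_sub {H : ℝ} (h0 : 0 < H) (h1 : H < 1) (s t : ℝ) :
    Integrable (fun u => (mvnKernel H t u - mvnKernel H s u) ^ 2) := by
  wlog hst : s < t generalizing s t
  · rcases (not_lt.1 hst).eq_or_lt with rfl | h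
    · simp
    · refine (this t s h).congr (ae_of_all _ fun u => ?_)
      ring
  have h2 := (integrable_sq_mvnKernel_one_sub_zero h0 h1).const_mul ((t - s) ^ (2 * H - 1))
  simp_rw [← sq_mvnKernel_sub_comp_affine hst] at h2
  have h3 := (integrable_comp_mul_left_iff
    (fun v => (mvnKernel H t (s + v) - mvnKernel H s (s + v)) ^ 2)
    (show t - s ≠ 0 by linarith)).1 h2
  simpa using h3.comp_add_left (-s)

/-- The increments of the kernel have the `L²` norms of the increments of fractional Brownian
motion, up to the constant `mvnConst H`. -/
lemma integral_sq_mvnKernel_sub {H : ℝ} (h0 : 0 < H) (s t : ℝ) :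
    ∫ u, (mvnKernel H t u - mvnKernel H s u) ^ 2 = mvnConst H * |t - s| ^ (2 * H) := by
  wlog hst : s < t generalizing s t
  · rcases (not_lt.1 hst).eq_or_lt with rfl | h
    · simp [Real.zero_rpow (show 2 * H ≠ 0 by positivity)]
    · rw [abs_sub_comm, ← this t s h]
      congr 1; ext u; ring
  have hh : 0 < t - s := by linarith
  have e1 : ∫ v, (mvnKernel H t (s + (t - s) * v) - mvnKernel H s (s + (t - s) * v)) ^ 2
      = (t - s) ^ (2 * H - 1) * mvnConst H := by
    simp_rw [sq_mvnKernel_sub_comp_affine hst]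
    rw [integral_const_mul]; rfl
  rw [Measure.integral_comp_mul_left
    (fun v => (mvnKernel H t (s + v) - mvnKernel H s (s + v)) ^ 2) (t - s),
    integral_add_left_eq_self (fun v => (mvnKernel H t v - mvnKernel H s v) ^ 2)] at e1
  rw [abs_of_pos (inv_pos.2 hh), smul_eq_mul, inv_mul_eq_iff_eq_mul₀ hh.ne'] at e1
  rw [e1, abs_of_pos hh, mul_comm (mvnConst H), ← mul_assoc]
  congr 1
  nth_rewrite 1 [← Real.rpow_one (t - s)]
  rw [← Real.rpow_add hh]; congr 1; ring

/-- The covariance of the increments `B_s - B_r` and `B_v - B_u` of a one-dimensional fractional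
Brownian motion. -/
noncomputable def incCov (H r s u v : ℝ) : ℝ :=
  (|s - u| ^ (2 * H) + |r - v| ^ (2 * H) - |s - v| ^ (2 * H) - |r - u| ^ (2 * H)) / 2

lemma integral_sq_mvnKernel_comb {H : ℝ} (h0 : 0 < H) (h1 : H < 1) (r s u v θ : ℝ) :
    Integrable (fun x => ((mvnKernel H s x - mvnKernel H r x)
      - θ * (mvnKernel H v x - mvnKernel H u x)) ^ 2) ∧
    ∫ x, ((mvnKernel H s x - mvnKernel H r x) - θ * (mvnKernel H v x - mvnKernel H u x)) ^ 2
      = mvnConst H *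
        (|s - r| ^ (2 * H) - 2 * θ * incCov H r s u v + θ ^ 2 * |v - u| ^ (2 * H)) := by
  have I := fun a b => integrable_sq_mvnKernel_sub h0 h1 a b
  -- polarization: the cross term is a combination of squares of increments
  have e : (fun x => ((mvnKernel H s x - mvnKernel H r x)
      - θ * (mvnKernel H v x - mvnKernel H u x)) ^ 2) = fun x =>
      ((((mvnKernel H s x - mvnKernel H r x) ^ 2 + θ ^ 2 * (mvnKernel H v x - mvnKernel H u x) ^ 2)
      - θ * (mvnKernel H s x - mvnKernel H u x) ^ 2) - θ * (mvnKernel H r x - mvnKernel H v x) ^ 2)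
      + θ * (mvnKernel H s x - mvnKernel H v x) ^ 2
      + θ * (mvnKernel H r x - mvnKernel H u x) ^ 2 := by
    ext x; ring
  have J1 := (I r s).add ((I u v).const_mul (θ ^ 2))
  have J2 := J1.sub ((I u s).const_mul θ)
  have J3 := J2.sub ((I v r).const_mul θ)
  have J4 := J3.add ((I v s).const_mul θ)
  have J5 := J4.add ((I u r).const_mul θ)
  rw [e]
  refine ⟨J5, ?_⟩
  refine (integral_add' J4 ((I u r).const_mul θ)).trans ?_
  rw [integral_add' J3 ((I v s).const_mul θ),
    integral_sub' J2 ((I v r).const_mul θ), integral_sub' J1 ((I u s).const_mul θ),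
    integral_add' (I r s) ((I u v).const_mul (θ ^ 2))]
  simp only [integral_const_mul, integral_sq_mvnKernel_sub h0]
  unfold incCov
  ring

/-- If all other times precede `s - h`, then on `(s - h, s)` only the kernel of `s` is nonzero. -/
lemma le_integral_sq_mvnKernel_comb {H : ℝ} (h0 : 0 < H) (h1 : H < 1) {r s u v h : ℝ} (θ : ℝ)
    (hh : 0 ≤ h) (hr : r ≤ s - h) (hu : u ≤ s - h) (hv : v ≤ s - h) :
    h ^ (2 * H) / (2 * H) ≤ ∫ x, ((mvnKernel H s x - mvnKernel H r x)
      - θ * (mvnKernel H v x - mvnKernel H u x)) ^ 2 := by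
  have hint := (integral_sq_mvnKernel_comb h0 h1 r s u v θ).1
  calc h ^ (2 * H) / (2 * H) = ∫ x in (s - h)..s, (s - x) ^ (2 * H - 1) := by
        rw [intervalIntegral.integral_comp_sub_left (fun x => x ^ (2 * H - 1)) s,
          integral_rpow (Or.inl (by linarith))]
        simp [Real.zero_rpow (show 2 * H ≠ 0 by positivity)]
    _ = ∫ x in Set.Ioo (s - h) s, (s - x) ^ (2 * H - 1) := by
        rw [intervalIntegral.integral_of_le (by linarith), integral_Ioc_eq_integral_Ioo]
    _ = ∫ x in Set.Ioo (s - h) s, ((mvnKernel H s x - mvnKernel H r x)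
      - θ * (mvnKernel H v x - mvnKernel H u x)) ^ 2 := by
        refine setIntegral_congr_fun measurableSet_Ioo fun x hx => ?_
        have a1 := hx.1
        have a2 := hx.2
        simp only [mvnKernel]
        rw [if_pos a2, if_neg (by linarith), if_neg (by linarith), if_neg (by linarith)]
        rw [sub_zero, sub_zero, mul_zero, sub_zero, ← Real.rpow_natCast,
          ← Real.rpow_mul (by linarith)]
        congr 1; push_cast; ring
    _ ≤ _ := setIntegral_le_integral hint (ae_of_all _ fun x => sq_nonneg _)

lemma mvnConst_pos {H : ℝ} (h0 : 0 < H) (h1 : H < 1) : 0 < mvnConst H := by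
  have h2 := le_integral_sq_mvnKernel_comb h0 h1 (r := 0) (s := 1) (u := 0) (v := 0) (h := 1) 0
    (by norm_num) (by norm_num) (by norm_num) (by norm_num)
  rw [Real.one_rpow] at h2
  simp only [zero_mul, sub_zero] at h2
  exact lt_of_lt_of_le (by positivity) h2

/-- The determinant of the covariance matrix of the increments `B_s - B_r` and `B_v - B_u`. -/
noncomputable def gramDet (H r s u v : ℝ) : ℝ :=
  |s - r| ^ (2 * H) * |v - u| ^ (2 * H) - incCov H r s u v ^ 2

/-- The determinant as the residual variance of the first increment given the second one, times the
variance of the second one. -/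
lemma gramDet_eq_quadratic {H r s u v : ℝ} (h : |v - u| ^ (2 * H) ≠ 0) :
    gramDet H r s u v = |v - u| ^ (2 * H) * (|s - r| ^ (2 * H)
      - 2 * (incCov H r s u v / |v - u| ^ (2 * H)) * incCov H r s u v
      + (incCov H r s u v / |v - u| ^ (2 * H)) ^ 2 * |v - u| ^ (2 * H)) := by
  unfold gramDet
  field_simp
  ring

lemma gramDet_nonneg {H : ℝ} (h0 : 0 < H) (h1 : H < 1) (r s u v : ℝ) : 0 ≤ gramDet H r s u v := by
  have hρ : 0 ≤ |v - u| ^ (2 * H) := by positivity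
  rcases hρ.eq_or_lt with h | h
  · have : u = v := by
      by_contra hne
      have : 0 < |v - u| := abs_pos.2 (sub_ne_zero.2 (Ne.symm hne))
      have := Real.rpow_pos_of_pos this (2 * H)
      linarith
    subst this
    simp only [gramDet, incCov, sub_self, abs_zero, Real.zero_rpow (show 2 * H ≠ 0 by positivity)]
    ring_nf; exact le_rfl
  · rw [gramDet_eq_quadratic h.ne']
    refine mul_nonneg hρ ?_
    have h3 := (integral_sq_mvnKernel_comb h0 h1 r s u v (incCov H r s u v / |v - u| ^ (2 * H))).2
    have h4 : 0 ≤ ∫ x, ((mvnKernel H s x - mvnKernel H r x)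
      - (incCov H r s u v / |v - u| ^ (2 * H)) * (mvnKernel H v x - mvnKernel H u x)) ^ 2 :=
      integral_nonneg fun x => sq_nonneg _
    rw [h3] at h4
    exact nonneg_of_mul_nonneg_right h4 (mvnConst_pos h0 h1)

/-- The constant in the local nondeterminism bound: `1 / (2 * H)` is the integral of
`(1 - u) ^ (2 * H - 1)` over `(0, 1)`, divided by the normalisation `mvnConst H`. -/
noncomputable def lndConst (H : ℝ) : ℝ := 1 / (2 * H * mvnConst H)

lemma lndConst_pos {H : ℝ} (h0 : 0 < H) (h1 : H < 1) : 0 < lndConst H := by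
  have := mvnConst_pos h0 h1
  unfold lndConst; positivity

/-- Local nondeterminism: the latest time keeps variance of order `h ^ (2 * H)` given the three
other times, where `h` is its distance to them. -/
lemma lndConst_mul_le_gramDet {H : ℝ} (h0 : 0 < H) (h1 : H < 1) {r s u v h : ℝ}
    (hh : 0 ≤ h) (hr : r ≤ s - h) (hu : u ≤ s - h) (hv : v ≤ s - h) :
    lndConst H * h ^ (2 * H) * |v - u| ^ (2 * H) ≤ gramDet H r s u v := by
  have hρ : 0 ≤ |v - u| ^ (2 * H) := by positivity
  rcases hρ.eq_or_lt with h2 | h2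
  · rw [← h2, mul_zero]; exact gramDet_nonneg h0 h1 _ _ _ _
  rw [gramDet_eq_quadratic h2.ne', mul_comm]
  refine mul_le_mul_of_nonneg_left ?_ hρ
  have h3 := le_integral_sq_mvnKernel_comb h0 h1 (incCov H r s u v / |v - u| ^ (2 * H)) hh hr hu hv
  rw [(integral_sq_mvnKernel_comb h0 h1 r s u v _).2, ← div_le_iff₀' (mvnConst_pos h0 h1)] at h3
  refine le_trans (le_of_eq ?_) h3
  unfold lndConst
  field_simp

lemma incCov_neg (H r s u v : ℝ) : incCov H (-r) (-s) (-u) (-v) = incCov H r s u v := by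
  unfold incCov
  simp only [neg_sub_neg]
  rw [abs_sub_comm u s, abs_sub_comm v r, abs_sub_comm v s, abs_sub_comm u r]

lemma incCov_comm (H r s u v : ℝ) : incCov H u v r s = incCov H r s u v := by
  unfold incCov
  rw [abs_sub_comm u s, abs_sub_comm v r, abs_sub_comm v s, abs_sub_comm u r]
  ring

lemma incCov_swap (H r s u v : ℝ) : incCov H s r v u = incCov H r s u v := by
  unfold incCov; ring

lemma gramDet_comm (H r s u v : ℝ) : gramDet H u v r s = gramDet H r s u v := by
  unfold gramDet; rw [incCov_comm, mul_comm]

/-- Local nondeterminism for the earliest time, by time reversal. -/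
lemma lndConst_mul_le_gramDet' {H : ℝ} (h0 : 0 < H) (h1 : H < 1) {r s u v h : ℝ}
    (hh : 0 ≤ h) (hs : r + h ≤ s) (hu : r + h ≤ u) (hv : r + h ≤ v) :
    lndConst H * h ^ (2 * H) * |v - u| ^ (2 * H) ≤ gramDet H r s u v := by
  have h2 := lndConst_mul_le_gramDet h0 h1 (r := -s) (s := -r) (u := -v) (v := -u) hh
    (by linarith) (by linarith) (by linarith)
  have h3 : gramDet H (-s) (-r) (-v) (-u) = gramDet H r s u v := by
    unfold gramDet
    rw [incCov_neg, incCov_swap, neg_sub_neg, neg_sub_neg]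
  rw [h3, neg_sub_neg] at h2
  exact h2

/-! ### Bounds on the covariance of two increments -/

lemma sq_incCov_le {H : ℝ} (h0 : 0 < H) (h1 : H < 1) (r s u v : ℝ) :
    incCov H r s u v ^ 2 ≤ |s - r| ^ (2 * H) * |v - u| ^ (2 * H) := by
  have := gramDet_nonneg h0 h1 r s u v
  unfold gramDet at this; linarith

/-- The covariance of nested increments is at most of order `b ^ min (2 * H) 1`, where `b` is the
length of the inner interval; the Cauchy–Schwarz bound would only give the order `b ^ H`. -/
lemma abs_incCov_nested_le {H : ℝ} (h0 : 0 < H) (h1 : H < 1) {r s u v T : ℝ} (hT : 1 ≤ T)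
    (hru : r < u) (huv : u < v) (hvs : v < s) (hsT : s - r ≤ T) :
    |incCov H r s u v| ≤ 2 * T * (v - u) ^ min (2 * H) 1 := by
  have key : ∀ a b : ℝ, 0 < a → 0 < b → a + b ≤ T →
      0 ≤ (a + b) ^ (2 * H) - a ^ (2 * H) ∧
        (a + b) ^ (2 * H) - a ^ (2 * H) ≤ 2 * T * b ^ min (2 * H) 1 := by
    intro a b ha hb hab
    refine ⟨sub_nonneg.2 (Real.rpow_le_rpow ha.le (by linarith) (by linarith)), ?_⟩
    rcases le_total (2 * H) 1 with h | h
    · rw [min_eq_left h]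
      have h2 := Real.rpow_add_le_add_rpow ha.le hb.le (p := 2 * H) (by linarith) h
      have h3 := Real.rpow_nonneg hb.le (2 * H)
      nlinarith
    · rw [min_eq_right h, Real.rpow_one]
      have hder : ∀ x ∈ Set.Ioo a (a + b),
          HasDerivAt (fun x : ℝ => x ^ (2 * H)) (2 * H * x ^ (2 * H - 1)) x :=
        fun x hx => Real.hasDerivAt_rpow_const (Or.inl (by have := hx.1; linarith))
      obtain ⟨c, hc, hc'⟩ := exists_hasDerivAt_eq_slope (fun x : ℝ => x ^ (2 * H))
        (fun x => 2 * H * x ^ (2 * H - 1)) (show a < a + b by linarith)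
        (fun x hx => (Real.continuousAt_rpow_const _ _
          (Or.inl (by have := hx.1; linarith))).continuousWithinAt) hder
      have e : (a + b) ^ (2 * H) - a ^ (2 * H) = 2 * H * c ^ (2 * H - 1) * b := by
        rw [hc', add_sub_cancel_left, div_mul_cancel₀ _ hb.ne']
      have hcT : c ^ (2 * H - 1) ≤ T := by
        calc c ^ (2 * H - 1) ≤ T ^ (2 * H - 1) :=
              Real.rpow_le_rpow (by linarith [hc.1]) (by linarith [hc.2]) (by linarith)
          _ ≤ T ^ (1 : ℝ) := Real.rpow_le_rpow_of_exponent_le hT (by linarith)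
          _ = T := Real.rpow_one T
      rw [e]
      have h5 : 0 ≤ c ^ (2 * H - 1) := Real.rpow_nonneg (by linarith [hc.1]) _
      refine mul_le_mul_of_nonneg_right ?_ hb.le
      nlinarith
  have k1 := key (s - v) (v - u) (by linarith) (by linarith) (by linarith)
  have k2 := key (u - r) (v - u) (by linarith) (by linarith) (by linarith)
  unfold incCov
  rw [abs_of_pos (show 0 < s - u by linarith), abs_of_pos (show 0 < s - v by linarith),
    abs_of_neg (show r - v < 0 by linarith), abs_of_neg (show r - u < 0 by linarith)]
  rw [show s - v + (v - u) = s - u by ring] at k1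
  rw [show u - r + (v - u) = -(r - v) by ring, show u - r = -(r - u) by ring] at k2
  rw [abs_le]
  constructor <;> linarith [k1.1, k1.2, k2.1, k2.2]

/-- Two increments separated by a gap decorrelate. -/
lemma abs_incCov_disjoint_le {H : ℝ} (h0 : 0 < H) (h1 : H < 1) {r s u v : ℝ}
    (hrs : r < s) (hsu : s < u) (huv : u < v) :
    |incCov H r s u v| ≤ (s - r) * (v - u) * (u - s) ^ (2 * H - 2) := by
  have ha : 0 < s - r := by linarith
  have hb : 0 < u - s := by linarith
  -- mean value theorem for `x ↦ (a + x) ^ 2H - x ^ 2H` between `b` and `b + c`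
  have hder : ∀ x ∈ Set.Ioo (u - s) (v - s),
      HasDerivAt (fun x : ℝ => (s - r + x) ^ (2 * H) - x ^ (2 * H))
        (1 * (2 * H) * (s - r + x) ^ (2 * H - 1) - 2 * H * x ^ (2 * H - 1)) x := by
    intro x hx
    have hx0 : 0 < x := hb.trans hx.1
    exact (((hasDerivAt_id x).const_add (s - r)).rpow_const
      (Or.inl (by simp only [id]; linarith))).sub
      (Real.hasDerivAt_rpow_const (Or.inl hx0.ne'))
  have hcont : ContinuousOn (fun x : ℝ => (s - r + x) ^ (2 * H) - x ^ (2 * H))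
      (Set.Icc (u - s) (v - s)) := by
    refine Continuous.continuousOn ?_
    exact ((continuous_const.add continuous_id).rpow_const fun _ => Or.inr (by linarith)).sub
      (continuous_id.rpow_const fun _ => Or.inr (by linarith))
  obtain ⟨ξ, hξ, hξ'⟩ := exists_hasDerivAt_eq_slope _ _ (show u - s < v - s by linarith) hcont hder
  have hξ0 : 0 < ξ := hb.trans hξ.1
  have hder2 : ∀ x ∈ Set.Ioo ξ (s - r + ξ),
      HasDerivAt (fun x : ℝ => x ^ (2 * H - 1)) ((2 * H - 1) * x ^ (2 * H - 1 - 1)) x :=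
    fun x hx => Real.hasDerivAt_rpow_const (Or.inl (by have := hx.1; linarith))
  obtain ⟨ζ, hζ, hζ'⟩ := exists_hasDerivAt_eq_slope (fun x : ℝ => x ^ (2 * H - 1))
    (fun x => (2 * H - 1) * x ^ (2 * H - 1 - 1)) (show ξ < s - r + ξ by linarith)
    (fun x hx => (Real.continuousAt_rpow_const _ _
      (Or.inl (by have := hx.1; linarith))).continuousWithinAt) hder2
  have hζ0 : u - s < ζ := hξ.1.trans hζ.1
  have e2 : (s - r + ξ) ^ (2 * H - 1) - ξ ^ (2 * H - 1)
      = (2 * H - 1) * ζ ^ (2 * H - 2) * (s - r) := by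
    rw [show 2 * H - 2 = 2 * H - 1 - 1 by ring, hζ']
    rw [show s - r + ξ - ξ = s - r by ring]; field_simp
  have e1 : 2 * incCov H r s u v
      = 2 * H * ((2 * H - 1) * ζ ^ (2 * H - 2) * (s - r)) * (v - u) := by
    rw [← e2, show 2 * H * ((s - r + ξ) ^ (2 * H - 1) - ξ ^ (2 * H - 1))
      = 1 * (2 * H) * (s - r + ξ) ^ (2 * H - 1) - 2 * H * ξ ^ (2 * H - 1) by ring, hξ']
    unfold incCov
    rw [abs_of_neg (show s - u < 0 by linarith), abs_of_neg (show s - v < 0 by linarith),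
      abs_of_neg (show r - v < 0 by linarith), abs_of_neg (show r - u < 0 by linarith)]
    rw [show v - s - (u - s) = v - u by ring, show s - r + (v - s) = -(r - v) by ring,
      show s - r + (u - s) = -(r - u) by ring, show v - s = -(s - v) by ring,
      show u - s = -(s - u) by ring, div_mul_cancel₀ _ (show v - u ≠ 0 by linarith)]
    ring
  have e3 : incCov H r s u v = (H * (2 * H - 1)) * ((s - r) * (v - u) * ζ ^ (2 * H - 2)) := by
    linear_combination e1 / 2
  have hp : ζ ^ (2 * H - 2) ≤ (u - s) ^ (2 * H - 2) :=
    Real.rpow_le_rpow_of_nonpos hb hζ0.le (by linarith)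
  have hp0 : 0 ≤ ζ ^ (2 * H - 2) := Real.rpow_nonneg (by linarith) _
  have hac : 0 ≤ (s - r) * (v - u) := by nlinarith
  have hc1 : |H * (2 * H - 1)| ≤ 1 := by
    rw [abs_le]; constructor <;> nlinarith
  rw [e3, abs_mul, abs_of_nonneg (mul_nonneg hac hp0)]
  calc _ ≤ 1 * ((s - r) * (v - u) * ζ ^ (2 * H - 2)) :=
        mul_le_mul_of_nonneg_right hc1 (mul_nonneg hac hp0)
    _ ≤ _ := by rw [one_mul]; exact mul_le_mul_of_nonneg_left hp hac

/-! ### The dominating function and its bounds on the three time orderings -/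

/-- The function dominating the second moments of the approximations:
`|μ| ^ n * (λ ρ) ^ N * Δ ^ (-e)`, where `λ`, `ρ`, `μ` and `Δ` are the variances, the covariance and
the Gram determinant of the increments over `[r, s]` and `[u, v]`. -/
noncomputable def gramMajorant (H : ℝ) (N n : ℕ) (e r s u v : ℝ) : ℝ :=
  |incCov H r s u v| ^ n * (|s - r| ^ (2 * H) * |v - u| ^ (2 * H)) ^ N * gramDet H r s u v ^ (-e)

lemma gramMajorant_comm (H : ℝ) (N n : ℕ) (e r s u v : ℝ) :
    gramMajorant H N n e u v r s = gramMajorant H N n e r s u v := by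
  unfold gramMajorant
  rw [incCov_comm, gramDet_comm, mul_comm (|v - u| ^ (2 * H))]

lemma gramMajorant_nonneg {H : ℝ} (h0 : 0 < H) (h1 : H < 1) (N n : ℕ) (e r s u v : ℝ) :
    0 ≤ gramMajorant H N n e r s u v := by
  have := gramDet_nonneg h0 h1 r s u v
  unfold gramMajorant; positivity

/-- Bounds in logarithmic form, so that the exponents can be compared by linear arithmetic. -/
lemma gramMajorant_le_exp {H : ℝ} {N n : ℕ} {e r s u v lM lL lR lD : ℝ} (he : 0 ≤ e)
    (hM : |incCov H r s u v| ≤ Real.exp lM) (hL : |s - r| ^ (2 * H) ≤ Real.exp lL)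
    (hR : |v - u| ^ (2 * H) ≤ Real.exp lR) (hD : Real.exp lD ≤ gramDet H r s u v) :
    gramMajorant H N n e r s u v ≤ Real.exp (n * lM + N * (lL + lR) - e * lD) := by
  have hD0 : 0 < gramDet H r s u v := (Real.exp_pos _).trans_le hD
  have e1 : Real.exp (n * lM + N * (lL + lR) - e * lD)
      = Real.exp lM ^ n * (Real.exp lL * Real.exp lR) ^ N * Real.exp lD ^ (-e) := by
    rw [← Real.exp_add, ← Real.exp_nat_mul, ← Real.exp_nat_mul, ← Real.exp_mul, ← Real.exp_add,
      ← Real.exp_add]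
    congr 1; ring
  rw [e1]
  unfold gramMajorant
  have h3 : gramDet H r s u v ^ (-e) ≤ Real.exp lD ^ (-e) :=
    Real.rpow_le_rpow_of_nonpos (Real.exp_pos _) hD (by linarith)
  gcongr

lemma exp_convexComb_le {A B x θ : ℝ} (h0 : 0 ≤ θ) (h1 : θ ≤ 1) (hA : Real.exp A ≤ x)
    (hB : Real.exp B ≤ x) : Real.exp ((1 - θ) * A + θ * B) ≤ x := by
  have hx : 0 < x := (Real.exp_pos _).trans_le hA
  rw [← Real.le_log_iff_exp_le hx] at *
  nlinarith

lemma le_exp_convexComb {A B x θ : ℝ} (hx : 0 ≤ x) (h0 : 0 ≤ θ) (h1 : θ ≤ 1) (hA : x ≤ Real.exp A)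
    (hB : x ≤ Real.exp B) : x ≤ Real.exp ((1 - θ) * A + θ * B) := by
  rcases hx.eq_or_lt with h | h
  · rw [← h]; positivity
  rw [← Real.log_le_iff_le_exp h] at *
  nlinarith

lemma abs_incCov_le_exp {H : ℝ} (h0 : 0 < H) (h1 : H < 1) {r s u v lL lR : ℝ}
    (hL : |s - r| ^ (2 * H) = Real.exp lL) (hR : |v - u| ^ (2 * H) = Real.exp lR) :
    |incCov H r s u v| ≤ Real.exp ((lL + lR) / 2) := by
  have h := sq_incCov_le h0 h1 r s u v
  rw [hL, hR, ← Real.exp_add] at h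
  refine abs_le_of_sq_le_sq ?_ (Real.exp_pos _).le
  rw [← Real.exp_nat_mul]
  refine h.trans (le_of_eq ?_)
  congr 1; push_cast; ring

lemma abs_sub_rpow_eq_exp {x y H : ℝ} (h : x < y) :
    |y - x| ^ (2 * H) = Real.exp (2 * H * Real.log (y - x)) := by
  rw [abs_of_pos (by linarith), Real.rpow_def_of_pos (by linarith), mul_comm]

lemma lndConst_mul_eq_exp {H x y ρ l : ℝ} (h0 : 0 < H) (h1 : H < 1) (h : x < y)
    (hρ : ρ = Real.exp l) :
    lndConst H * (y - x) ^ (2 * H) * ρ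
      = Real.exp (Real.log (lndConst H) + 2 * H * Real.log (y - x) + l) := by
  rw [hρ, Real.exp_add, Real.exp_add, Real.exp_log (lndConst_pos h0 h1),
    Real.rpow_def_of_pos (by linarith), mul_comm (Real.log _)]

lemma const_mul_rpow_eq_exp {C x a b c α β γ : ℝ} (hC : C = Real.exp x)
    (ha : 0 < a) (hb : 0 < b) (hc : 0 < c) :
    C * (a ^ α * b ^ β * c ^ γ)
      = Real.exp (x + α * Real.log a + β * Real.log b + γ * Real.log c) := by
  rw [Real.rpow_def_of_pos ha, Real.rpow_def_of_pos hb, Real.rpow_def_of_pos hc, hC,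
    ← Real.exp_add, ← Real.exp_add, ← Real.exp_add]
  congr 1; ring

/-- Overlapping intervals: `x₁ < x₂ < x₃ < x₄` with the increments over `[x₁, x₃]` and
`[x₂, x₄]`. -/
lemma gramMajorant_overlap_le {H : ℝ} (h0 : 0 < H) (h1 : H < 1) {N n : ℕ} {d e : ℝ} (hd : 0 ≤ d)
    (he : e = 2 * N + n + d / 2) :
    ∃ C : ℝ, 0 < C ∧ ∀ x₁ x₂ x₃ x₄ : ℝ, x₁ < x₂ → x₂ < x₃ → x₃ < x₄ →
      gramMajorant H N n e x₁ x₃ x₂ x₄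
        ≤ C * ((x₂ - x₁) ^ (-(H * e)) * (x₃ - x₂) ^ (-(H * d)) * (x₄ - x₃) ^ (-(H * e))) := by
  refine ⟨Real.exp (-e * Real.log (lndConst H)), Real.exp_pos _, fun x₁ x₂ x₃ x₄ h12 h23 h34 => ?_⟩
  have he0 : 0 ≤ e := by rw [he]; positivity
  have hL := abs_sub_rpow_eq_exp (H := H) (h12.trans h23)
  have hR := abs_sub_rpow_eq_exp (H := H) (h23.trans h34)
  have hM := abs_incCov_le_exp h0 h1 hL hR
  have D1 := lndConst_mul_le_gramDet' h0 h1 (r := x₁) (s := x₃) (u := x₂) (v := x₄) (h := x₂ - x₁)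
    (by linarith) (by linarith) (by linarith) (by linarith)
  have D2 := lndConst_mul_le_gramDet h0 h1 (r := x₂) (s := x₄) (u := x₁) (v := x₃) (h := x₄ - x₃)
    (by linarith) (by linarith) (by linarith) (by linarith)
  rw [gramDet_comm, lndConst_mul_eq_exp h0 h1 h34 hL] at D2
  rw [lndConst_mul_eq_exp h0 h1 h12 hR] at D1
  have D := exp_convexComb_le (θ := 1 / 2) (by norm_num) (by norm_num) D1 D2
  refine (gramMajorant_le_exp he0 hM hL.le hR.le D).trans ?_
  rw [const_mul_rpow_eq_exp rfl (by linarith) (by linarith) (by linarith)]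
  refine Real.exp_le_exp.2 ?_
  have hb1 : Real.log (x₃ - x₂) ≤ Real.log (x₃ - x₁) :=
    Real.log_le_log (by linarith) (by linarith)
  have hb2 : Real.log (x₃ - x₂) ≤ Real.log (x₄ - x₂) :=
    Real.log_le_log (by linarith) (by linarith)
  have k1 := mul_le_mul_of_nonneg_left hb1 (show 0 ≤ d / 4 * (2 * H) by positivity)
  have k2 := mul_le_mul_of_nonneg_left hb2 (show 0 ≤ d / 4 * (2 * H) by positivity)
  have e2 : (n : ℝ) = e - 2 * N - d / 2 := by rw [he]; ring
  rw [e2]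
  linarith

/-- Nested intervals: `x₁ < x₂ < x₃ < x₄` with the increments over `[x₁, x₄]` and `[x₂, x₃]`. -/
lemma gramMajorant_nested_le {H : ℝ} (h0 : 0 < H) (h1 : H < 1) {N n : ℕ} {d e T : ℝ} (hd : 0 ≤ d)
    (he : e = 2 * N + n + d / 2) (hT : 1 ≤ T) :
    ∃ C : ℝ, 0 < C ∧ ∀ x₁ x₂ x₃ x₄ : ℝ, x₁ < x₂ → x₂ < x₃ → x₃ < x₄ → x₄ - x₁ ≤ T →
      gramMajorant H N n e x₁ x₄ x₂ x₃
        ≤ C * ((x₂ - x₁) ^ (-(H * e)) * (x₃ - x₂) ^ (-(H * (2 * N + 2 * n + d) - n * min (2 * H) 1))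
          * (x₄ - x₃) ^ (-(H * e))) := by
  refine ⟨Real.exp (n * Real.log (2 * T) + N * (2 * H * Real.log T) - e * Real.log (lndConst H)),
    Real.exp_pos _, fun x₁ x₂ x₃ x₄ h12 h23 h34 h14 => ?_⟩
  have he0 : 0 ≤ e := by rw [he]; positivity
  have hL := abs_sub_rpow_eq_exp (H := H) (h12.trans (h23.trans h34))
  have hR := abs_sub_rpow_eq_exp (H := H) h23
  have hM : |incCov H x₁ x₄ x₂ x₃| ≤
      Real.exp (Real.log (2 * T) + min (2 * H) 1 * Real.log (x₃ - x₂)) := by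
    refine (abs_incCov_nested_le h0 h1 hT h12 h23 h34 h14).trans (le_of_eq ?_)
    rw [Real.exp_add, Real.exp_log (by linarith), Real.rpow_def_of_pos (by linarith),
      mul_comm (Real.log (x₃ - x₂))]
  have D1 := lndConst_mul_le_gramDet' h0 h1 (r := x₁) (s := x₄) (u := x₂) (v := x₃) (h := x₂ - x₁)
    (by linarith) (by linarith) (by linarith) (by linarith)
  have D2 := lndConst_mul_le_gramDet h0 h1 (r := x₁) (s := x₄) (u := x₂) (v := x₃) (h := x₄ - x₃)
    (by linarith) (by linarith) (by linarith) (by linarith)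
  rw [lndConst_mul_eq_exp h0 h1 h34 hR] at D2
  rw [lndConst_mul_eq_exp h0 h1 h12 hR] at D1
  have D := exp_convexComb_le (θ := 1 / 2) (by norm_num) (by norm_num) D1 D2
  refine (gramMajorant_le_exp he0 hM hL.le hR.le D).trans ?_
  rw [const_mul_rpow_eq_exp rfl (by linarith) (by linarith) (by linarith)]
  refine Real.exp_le_exp.2 ?_
  have hb1 : Real.log (x₄ - x₁) ≤ Real.log T := Real.log_le_log (by linarith) h14
  have k1 := mul_le_mul_of_nonneg_left hb1 (show 0 ≤ N * (2 * H) by positivity)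
  have e2 : d = 2 * e - 4 * N - 2 * n := by rw [he]; ring
  rw [e2]
  linarith

/-- Disjoint intervals: `x₁ < x₂ < x₃ < x₄` with the increments over `[x₁, x₂]` and `[x₃, x₄]`.
The parameter `θ` interpolates between the Cauchy–Schwarz bound and the decay in the gap. -/
lemma gramMajorant_disjoint_le {H : ℝ} (h0 : 0 < H) (h1 : H < 1) {N n : ℕ} {d e θ : ℝ} (hd : 0 ≤ d)
    (he : e = 2 * N + n + d / 2) (hθ0 : 0 ≤ θ) (hθ1 : θ ≤ 1) :
    ∃ C : ℝ, 0 < C ∧ ∀ x₁ x₂ x₃ x₄ : ℝ, x₁ < x₂ → x₂ < x₃ → x₃ < x₄ →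
      gramMajorant H N n e x₁ x₂ x₃ x₄
        ≤ C * ((x₂ - x₁) ^ (-(H * (2 * N + n + d) - n * θ * (1 - H)))
          * (x₃ - x₂) ^ (-(2 * (n * θ * (1 - H))))
          * (x₄ - x₃) ^ (-(H * (2 * N + n + d) - n * θ * (1 - H)))) := by
  refine ⟨Real.exp (-e * Real.log (lndConst H)), Real.exp_pos _, fun x₁ x₂ x₃ x₄ h12 h23 h34 => ?_⟩
  have he0 : 0 ≤ e := by rw [he]; positivity
  have hL := abs_sub_rpow_eq_exp (H := H) h12
  have hR := abs_sub_rpow_eq_exp (H := H) h34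
  have hM1 := abs_incCov_le_exp h0 h1 hL hR
  have hM2 : |incCov H x₁ x₂ x₃ x₄| ≤ Real.exp (Real.log (x₂ - x₁) + Real.log (x₄ - x₃)
      + (2 * H - 2) * Real.log (x₃ - x₂)) := by
    refine (abs_incCov_disjoint_le h0 h1 h12 h23 h34).trans (le_of_eq ?_)
    rw [Real.exp_add, Real.exp_add, Real.exp_log (by linarith), Real.exp_log (by linarith),
      Real.rpow_def_of_pos (by linarith), mul_comm (Real.log (x₃ - x₂))]
  have hM := le_exp_convexComb (abs_nonneg _) hθ0 hθ1 hM1 hM2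
  have D := lndConst_mul_le_gramDet' h0 h1 (r := x₁) (s := x₂) (u := x₃) (v := x₄) (h := x₂ - x₁)
    (by linarith) (by linarith) (by linarith) (by linarith)
  rw [lndConst_mul_eq_exp h0 h1 h12 hR] at D
  refine (gramMajorant_le_exp he0 hM hL.le hR.le D).trans ?_
  rw [const_mul_rpow_eq_exp rfl (by linarith) (by linarith) (by linarith)]
  refine Real.exp_le_exp.2 (le_of_eq ?_)
  rw [he]
  ring

lemma gramDet_pos_of_lt {H : ℝ} (h0 : 0 < H) (h1 : H < 1) {r s u v : ℝ} (hrs : r < s) (huv : u < v)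
    (hvs : v < s) : 0 < gramDet H r s u v := by
  obtain ⟨w, hw1, hw2⟩ : ∃ w, max r v < w ∧ w < s := exists_between (max_lt hrs hvs)
  have hr : r < w := (le_max_left _ _).trans_lt hw1
  have hv : v < w := (le_max_right _ _).trans_lt hw1
  have h := lndConst_mul_le_gramDet h0 h1 (r := r) (s := s) (u := u) (v := v) (h := s - w)
    (by linarith) (by linarith) (by linarith) (by linarith)
  refine lt_of_lt_of_le ?_ h
  have := lndConst_pos h0 h1
  have h2 : 0 < |v - u| := abs_pos.2 (by linarith)
  have h3 : 0 < s - w := by linarith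
  positivity

lemma gramDet_pos {H : ℝ} (h0 : 0 < H) (h1 : H < 1) {r s u v : ℝ} (hrs : r < s) (huv : u < v)
    (hvs : s ≠ v) : 0 < gramDet H r s u v := by
  rcases lt_or_gt_of_ne hvs with h | h
  · rw [gramDet_comm]; exact gramDet_pos_of_lt h0 h1 huv hrs h
  · exact gramDet_pos_of_lt h0 h1 hrs huv h

/-! ### Integrability of the dominating function -/

/-- The weight `x ^ a` on `(0, T)`, as an extended nonnegative function. -/
noncomputable def powWeight (T a x : ℝ) : ℝ≥0∞ :=
  (Set.Ioo 0 T).indicator (fun x => ENNReal.ofReal (x ^ a)) x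

@[fun_prop]
lemma measurable_powWeight (T a : ℝ) : Measurable (powWeight T a) :=
  Measurable.indicator (by fun_prop) measurableSet_Ioo

lemma powWeight_of_mem {T a x : ℝ} (h0 : 0 < x) (hT : x < T) :
    powWeight T a x = ENNReal.ofReal (x ^ a) :=
  Set.indicator_of_mem (show x ∈ Set.Ioo 0 T from ⟨h0, hT⟩) _

lemma lintegral_powWeight_lt_top {T a : ℝ} (hT : 0 ≤ T) (ha : -1 < a) :
    ∫⁻ x, powWeight T a x < ∞ := by
  unfold powWeight
  rw [lintegral_indicator measurableSet_Ioo]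
  have h := intervalIntegral.intervalIntegrable_rpow' ha (a := 0) (b := T)
  rw [intervalIntegrable_iff_integrableOn_Ioo_of_le hT] at h
  exact h.lintegral_lt_top

/-- The weight of four increasing times: a power of each of the three gaps. -/
noncomputable def chainWeight (T a b c x₁ x₂ x₃ x₄ : ℝ) : ℝ≥0∞ :=
  powWeight T 0 x₁ * (powWeight T a (x₂ - x₁) * (powWeight T b (x₃ - x₂) * powWeight T c (x₄ - x₃)))

lemma measurable_chainWeight {α : Type*} [MeasurableSpace α] (T a b c : ℝ) {f g h k : α → ℝ}
    (hf : Measurable f) (hg : Measurable g) (hh : Measurable h) (hk : Measurable k) :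
    Measurable fun z => chainWeight T a b c (f z) (g z) (h z) (k z) := by
  unfold chainWeight
  fun_prop

lemma lintegral_chainWeight_lt_top {T a b c : ℝ} (hT : 0 ≤ T) (ha : -1 < a) (hb : -1 < b)
    (hc : -1 < c) : ∫⁻ x₁, ∫⁻ x₂, ∫⁻ x₃, ∫⁻ x₄, chainWeight T a b c x₁ x₂ x₃ x₄ < ∞ := by
  unfold chainWeight
  have e4 : ∀ x₃ : ℝ, ∫⁻ x₄, powWeight T c (x₄ - x₃) = ∫⁻ x, powWeight T c x := fun x₃ =>
    lintegral_sub_right_eq_self (powWeight T c) x₃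
  have e3 : ∀ x₂ : ℝ, ∫⁻ x₃, powWeight T b (x₃ - x₂) = ∫⁻ x, powWeight T b x := fun x₂ =>
    lintegral_sub_right_eq_self (powWeight T b) x₂
  have e2 : ∀ x₁ : ℝ, ∫⁻ x₂, powWeight T a (x₂ - x₁) = ∫⁻ x, powWeight T a x := fun x₁ =>
    lintegral_sub_right_eq_self (powWeight T a) x₁
  have m4 : ∀ x₃ : ℝ, Measurable fun x₄ => powWeight T c (x₄ - x₃) := fun x₃ => by fun_prop
  have m3 : ∀ x₂ : ℝ, Measurable fun x₃ => powWeight T b (x₃ - x₂) := fun x₃ => by fun_prop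
  have m2 : ∀ x₁ : ℝ, Measurable fun x₂ => powWeight T a (x₂ - x₁) := fun x₃ => by fun_prop
  have f4 : ∀ x₁ x₂ x₃ : ℝ, ∫⁻ x₄, powWeight T 0 x₁ * (powWeight T a (x₂ - x₁) *
      (powWeight T b (x₃ - x₂) * powWeight T c (x₄ - x₃))) = powWeight T 0 x₁ *
      (powWeight T a (x₂ - x₁) * (powWeight T b (x₃ - x₂) * ∫⁻ x, powWeight T c x)) := by
    intro x₁ x₂ x₃
    rw [lintegral_const_mul _ (((m4 x₃).const_mul _).const_mul _),
      lintegral_const_mul _ ((m4 x₃).const_mul _), lintegral_const_mul _ (m4 x₃), e4]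
  simp_rw [f4]
  have f3 : ∀ x₁ x₂ : ℝ, ∫⁻ x₃, powWeight T 0 x₁ * (powWeight T a (x₂ - x₁) *
      (powWeight T b (x₃ - x₂) * ∫⁻ x, powWeight T c x)) = powWeight T 0 x₁ *
      (powWeight T a (x₂ - x₁) * ((∫⁻ x, powWeight T b x) * ∫⁻ x, powWeight T c x)) := by
    intro x₁ x₂
    rw [lintegral_const_mul _ (((m3 x₂).mul_const _).const_mul _),
      lintegral_const_mul _ ((m3 x₂).mul_const _), lintegral_mul_const _ (m3 x₂), e3]
  simp_rw [f3]
  have f2 : ∀ x₁ : ℝ, ∫⁻ x₂, powWeight T 0 x₁ * (powWeight T a (x₂ - x₁) *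
      ((∫⁻ x, powWeight T b x) * ∫⁻ x, powWeight T c x)) = powWeight T 0 x₁ *
      ((∫⁻ x, powWeight T a x) * ((∫⁻ x, powWeight T b x) * ∫⁻ x, powWeight T c x)) := by
    intro x₁
    rw [lintegral_const_mul _ ((m2 x₁).mul_const _), lintegral_mul_const _ (m2 x₁), e2]
  simp_rw [f2]
  rw [lintegral_mul_const _ (measurable_powWeight T 0)]
  exact ENNReal.mul_lt_top (lintegral_powWeight_lt_top hT (by norm_num))
    (ENNReal.mul_lt_top (lintegral_powWeight_lt_top hT ha)
    (ENNReal.mul_lt_top (lintegral_powWeight_lt_top hT hb) (lintegral_powWeight_lt_top hT hc)))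

lemma lintegral_pair_eq_iterated {F : ℝ → ℝ → ℝ → ℝ → ℝ≥0∞}
    (hF : Measurable fun p : (ℝ × ℝ) × (ℝ × ℝ) => F p.1.1 p.1.2 p.2.1 p.2.2) :
    ∫⁻ p : (ℝ × ℝ) × (ℝ × ℝ), F p.1.1 p.1.2 p.2.1 p.2.2
      = ∫⁻ r, ∫⁻ s, ∫⁻ u, ∫⁻ v, F r s u v := by
  rw [Measure.volume_eq_prod, lintegral_prod _ hF.aemeasurable, Measure.volume_eq_prod,
    lintegral_prod _ hF.lintegral_prod_right'.aemeasurable]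
  refine lintegral_congr fun r => lintegral_congr fun s => ?_
  exact lintegral_prod _ (hF.comp measurable_prodMk_left).aemeasurable

lemma lintegral_chainWeight_disjoint_lt_top {T a b c : ℝ} (hT : 0 ≤ T) (ha : -1 < a) (hb : -1 < b)
    (hc : -1 < c) :
    ∫⁻ p : (ℝ × ℝ) × (ℝ × ℝ), chainWeight T a b c p.1.1 p.1.2 p.2.1 p.2.2 < ∞ := by
  rw [lintegral_pair_eq_iterated
    (measurable_chainWeight T a b c (by fun_prop) (by fun_prop) (by fun_prop) (by fun_prop))]
  exact lintegral_chainWeight_lt_top hT ha hb hc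

lemma lintegral_chainWeight_overlap_lt_top {T a b c : ℝ} (hT : 0 ≤ T) (ha : -1 < a) (hb : -1 < b)
    (hc : -1 < c) :
    ∫⁻ p : (ℝ × ℝ) × (ℝ × ℝ), chainWeight T a b c p.1.1 p.2.1 p.1.2 p.2.2 < ∞ := by
  rw [lintegral_pair_eq_iterated (F := fun r s u v => chainWeight T a b c r u s v)
    (measurable_chainWeight T a b c (by fun_prop) (by fun_prop) (by fun_prop) (by fun_prop))]
  refine lt_of_eq_of_lt (lintegral_congr fun r => ?_) (lintegral_chainWeight_lt_top hT ha hb hc)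
  refine lintegral_lintegral_swap (Measurable.aemeasurable ?_)
  exact Measurable.lintegral_prod_right' (f := fun z : (ℝ × ℝ) × ℝ =>
    chainWeight T a b c r z.1.2 z.1.1 z.2)
    (measurable_chainWeight T a b c (by fun_prop) (by fun_prop) (by fun_prop) (by fun_prop))

lemma lintegral_chainWeight_nested_lt_top {T a b c : ℝ} (hT : 0 ≤ T) (ha : -1 < a) (hb : -1 < b)
    (hc : -1 < c) :
    ∫⁻ p : (ℝ × ℝ) × (ℝ × ℝ), chainWeight T a b c p.1.1 p.2.1 p.2.2 p.1.2 < ∞ := by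
  rw [lintegral_pair_eq_iterated (F := fun r s u v => chainWeight T a b c r u v s)
    (measurable_chainWeight T a b c (by fun_prop) (by fun_prop) (by fun_prop) (by fun_prop))]
  refine lt_of_eq_of_lt (lintegral_congr fun r => ?_) (lintegral_chainWeight_lt_top hT ha hb hc)
  rw [lintegral_lintegral_swap (Measurable.aemeasurable
    (Measurable.lintegral_prod_right' (f := fun z : (ℝ × ℝ) × ℝ =>
    chainWeight T a b c r z.1.2 z.2 z.1.1)
    (measurable_chainWeight T a b c (by fun_prop) (by fun_prop) (by fun_prop) (by fun_prop))))]
  refine lintegral_congr fun u => ?_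
  exact lintegral_lintegral_swap (Measurable.aemeasurable
    (measurable_chainWeight T a b c (by fun_prop) (by fun_prop) (by fun_prop) (by fun_prop)))

lemma volume_eq_zero_of_linear {E : Type*} [NormedAddCommGroup E] [NormedSpace ℝ E]
    [MeasurableSpace E] [BorelSpace E] [FiniteDimensional ℝ E] (μ : Measure E) [μ.IsAddHaarMeasure]
    (L : E →ₗ[ℝ] ℝ) (hL : L ≠ 0) : μ {x | L x = 0} = 0 := by
  have := Measure.addHaar_submodule μ (LinearMap.ker L) (by
    intro h; exact hL (LinearMap.ker_eq_top.1 h))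
  exact this

/-- Almost every pair of time intervals has four distinct end points. -/
lemma ae_times_ne : ∀ᵐ p : (ℝ × ℝ) × (ℝ × ℝ),
    p.1.1 ≠ p.2.1 ∧ p.1.1 ≠ p.2.2 ∧ p.1.2 ≠ p.2.1 ∧ p.1.2 ≠ p.2.2 := by
  have i1 : (volume : Measure (ℝ × ℝ)).IsAddHaarMeasure := by
    rw [Measure.volume_eq_prod]; infer_instance
  have i2 : (volume : Measure ((ℝ × ℝ) × (ℝ × ℝ))).IsAddHaarMeasure := by
    rw [Measure.volume_eq_prod]; infer_instance
  have key : ∀ L M : (ℝ × ℝ) × (ℝ × ℝ) →ₗ[ℝ] ℝ, L ≠ M →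
      ∀ᵐ p : (ℝ × ℝ) × (ℝ × ℝ), L p ≠ M p := by
    intro L M h
    have h2 := volume_eq_zero_of_linear (volume : Measure ((ℝ × ℝ) × (ℝ × ℝ))) (L - M)
      (sub_ne_zero.2 h)
    rw [ae_iff]
    simpa [sub_eq_zero] using h2
  let p1 := LinearMap.fst ℝ (ℝ × ℝ) (ℝ × ℝ)
  let p2 := LinearMap.snd ℝ (ℝ × ℝ) (ℝ × ℝ)
  let f := LinearMap.fst ℝ ℝ ℝ
  let g := LinearMap.snd ℝ ℝ ℝ
  have n1 : f ∘ₗ p1 ≠ f ∘ₗ p2 := fun h => by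
    simpa [f, p1, p2] using LinearMap.congr_fun h ((1, 0), (0, 0))
  have n2 : f ∘ₗ p1 ≠ g ∘ₗ p2 := fun h => by
    simpa [f, g, p1, p2] using LinearMap.congr_fun h ((1, 0), (0, 0))
  have n3 : g ∘ₗ p1 ≠ f ∘ₗ p2 := fun h => by
    simpa [f, g, p1, p2] using LinearMap.congr_fun h ((0, 1), (0, 0))
  have n4 : g ∘ₗ p1 ≠ g ∘ₗ p2 := fun h => by
    simpa [f, g, p1, p2] using LinearMap.congr_fun h ((0, 1), (0, 0))
  filter_upwards [key _ _ n1, key _ _ n2, key _ _ n3, key _ _ n4] with p h1 h2 h3 h4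
  exact ⟨h1, h2, h3, h4⟩

/-- A parameter `θ` for which the exponents in `gramMajorant_disjoint_le` exceed `-1`, where
`y = H * (|k| + d)`. -/
lemma exists_interpolation {H : ℝ} {n : ℕ} {y : ℝ} (hy : y < 3 / 2)
    (hn : y - n * (1 - H) < 1) :
    ∃ θ : ℝ, 0 ≤ θ ∧ θ ≤ 1 ∧ 2 * (n * θ * (1 - H)) < 1 ∧ y - n * θ * (1 - H) < 1 := by
  rcases lt_or_ge y 1 with hy1 | hy1
  · exact ⟨0, le_rfl, zero_le_one, by simp, by simpa using hy1⟩
  have hpos : 0 < n * (1 - H) := by linarith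
  obtain ⟨g, hg1, hg2⟩ : ∃ g, y - 1 < g ∧ g < min (1 / 2) (n * (1 - H)) :=
    exists_between (lt_min (by linarith) (by linarith))
  have hg3 := hg2.trans_le (min_le_left _ _)
  have hg4 := hg2.trans_le (min_le_right _ _)
  have e : n * (g / (n * (1 - H))) * (1 - H) = g := by
    rw [mul_right_comm, mul_div_cancel₀ _ hpos.ne']
  refine ⟨g / (n * (1 - H)), div_nonneg (by linarith) hpos.le, (div_le_one hpos).2 hg4.le, ?_, ?_⟩
  · rw [e]; linarith
  · rw [e]; linarith

lemma measurable_gramMajorant (H : ℝ) (N n : ℕ) (e : ℝ) :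
    Measurable fun p : (ℝ × ℝ) × (ℝ × ℝ) => gramMajorant H N n e p.1.1 p.1.2 p.2.1 p.2.2 := by
  unfold gramMajorant gramDet incCov
  fun_prop

lemma measurableSet_timeSimplex (t : ℝ) : MeasurableSet (timeSimplex t) := by
  unfold timeSimplex
  exact (measurableSet_lt measurable_const measurable_fst).inter
    ((measurableSet_lt measurable_fst measurable_snd).inter
      (measurableSet_lt measurable_snd measurable_const))

/-- The dominating function is integrable over pairs of time intervals.  The three conditions on `H`
come, in this order, from overlapping intervals whose non-shared parts shrink, from overlapping
intervals whose common part shrinks, and from nested intervals whose inner one shrinks; disjoint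
intervals need nothing more. -/
lemma integrableOn_gramMajorant {H : ℝ} (h0 : 0 < H) (h1 : H < 1) {N n : ℕ} {d : ℝ} (hd : 0 ≤ d)
    {t : ℝ} (ht : 0 ≤ t) (hA : H * (2 * (2 * N + n) + d) < 2) (hB : H * d < 1)
    (hC : H * (2 * N + 2 * n + d) - n * min (2 * H) 1 < 1) :
    IntegrableOn (fun p : (ℝ × ℝ) × (ℝ × ℝ) =>
      gramMajorant H N n (2 * N + n + d / 2) p.1.1 p.1.2 p.2.1 p.2.2)
      (timeSimplex t ×ˢ timeSimplex t) := by
  set e : ℝ := 2 * N + n + d / 2 with he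
  have hD : H * (2 * N + n + d) - n * (1 - H) < 1 := by
    have := mul_le_mul_of_nonneg_left (min_le_right (2 * H) 1) (Nat.cast_nonneg (α := ℝ) n)
    linarith
  have hy : H * (2 * N + n + d) < 3 / 2 := by linarith
  obtain ⟨θ, hθ0, hθ1, hθ2, hθ3⟩ := exists_interpolation hy hD
  obtain ⟨C1, hC1, b1⟩ := gramMajorant_overlap_le h0 h1 hd he
  obtain ⟨C2, hC2, b2⟩ := gramMajorant_nested_le h0 h1 hd he (show 1 ≤ t + 1 by linarith)
  obtain ⟨C3, hC3, b3⟩ := gramMajorant_disjoint_le h0 h1 hd he hθ0 hθ1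
  have q1 : -1 < -(H * e) := by rw [he]; linarith
  have q2 : -1 < -(H * d) := by linarith
  have q3 : -1 < -(H * (2 * N + 2 * n + d) - n * min (2 * H) 1) := by linarith
  have q4 : -1 < -(H * (2 * N + n + d) - n * θ * (1 - H)) := by linarith
  have q5 : -1 < -(2 * (n * θ * (1 - H))) := by linarith
  have hm := measurable_gramMajorant H N n e
  have hS : MeasurableSet (timeSimplex t ×ˢ timeSimplex t) :=
    (measurableSet_timeSimplex t).prod (measurableSet_timeSimplex t)
  -- one summand for each of the three orderings with `r < u`, and the same with `r > u`
  let W1 : ℝ → ℝ → ℝ → ℝ → ℝ≥0∞ := fun r s u v =>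
    ENNReal.ofReal C1 * chainWeight t (-(H * e)) (-(H * d)) (-(H * e)) r u s v
  let W2 : ℝ → ℝ → ℝ → ℝ → ℝ≥0∞ := fun r s u v => ENNReal.ofReal C2 * chainWeight t (-(H * e))
    (-(H * (2 * N + 2 * n + d) - n * min (2 * H) 1)) (-(H * e)) r u v s
  let W3 : ℝ → ℝ → ℝ → ℝ → ℝ≥0∞ := fun r s u v => ENNReal.ofReal C3 * chainWeight t
    (-(H * (2 * N + n + d) - n * θ * (1 - H))) (-(2 * (n * θ * (1 - H))))
    (-(H * (2 * N + n + d) - n * θ * (1 - H))) r s u v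
  let W : (ℝ × ℝ) × (ℝ × ℝ) → ℝ≥0∞ := fun p => W1 p.1.1 p.1.2 p.2.1 p.2.2
    + W2 p.1.1 p.1.2 p.2.1 p.2.2 + W3 p.1.1 p.1.2 p.2.1 p.2.2
  have mW1 : Measurable fun p : (ℝ × ℝ) × (ℝ × ℝ) => W1 p.1.1 p.1.2 p.2.1 p.2.2 :=
    (measurable_chainWeight _ _ _ _
      (by fun_prop) (by fun_prop) (by fun_prop) (by fun_prop)).const_mul _
  have mW2 : Measurable fun p : (ℝ × ℝ) × (ℝ × ℝ) => W2 p.1.1 p.1.2 p.2.1 p.2.2 :=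
    (measurable_chainWeight _ _ _ _
      (by fun_prop) (by fun_prop) (by fun_prop) (by fun_prop)).const_mul _
  have mW3 : Measurable fun p : (ℝ × ℝ) × (ℝ × ℝ) => W3 p.1.1 p.1.2 p.2.1 p.2.2 :=
    (measurable_chainWeight _ _ _ _
      (by fun_prop) (by fun_prop) (by fun_prop) (by fun_prop)).const_mul _
  have mW : Measurable W := (mW1.add mW2).add mW3
  have hW : ∫⁻ p, W p < ∞ := by
    have i1 : ∫⁻ p : (ℝ × ℝ) × (ℝ × ℝ), W1 p.1.1 p.1.2 p.2.1 p.2.2 < ∞ := by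
      rw [lintegral_const_mul' _ _ ENNReal.ofReal_ne_top]
      exact ENNReal.mul_lt_top ENNReal.ofReal_lt_top
        (lintegral_chainWeight_overlap_lt_top ht q1 q2 q1)
    have i2 : ∫⁻ p : (ℝ × ℝ) × (ℝ × ℝ), W2 p.1.1 p.1.2 p.2.1 p.2.2 < ∞ := by
      rw [lintegral_const_mul' _ _ ENNReal.ofReal_ne_top]
      exact ENNReal.mul_lt_top ENNReal.ofReal_lt_top
        (lintegral_chainWeight_nested_lt_top ht q1 q3 q1)
    have i3 : ∫⁻ p : (ℝ × ℝ) × (ℝ × ℝ), W3 p.1.1 p.1.2 p.2.1 p.2.2 < ∞ := by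
      rw [lintegral_const_mul' _ _ ENNReal.ofReal_ne_top]
      exact ENNReal.mul_lt_top ENNReal.ofReal_lt_top
        (lintegral_chainWeight_disjoint_lt_top ht q4 q5 q4)
    refine lt_of_eq_of_lt ((lintegral_add_left (mW1.add mW2) _).trans
      (congrArg (· + _) (lintegral_add_left mW1 _))) ?_
    exact ENNReal.add_lt_top.2 ⟨ENNReal.add_lt_top.2 ⟨i1, i2⟩, i3⟩
  have hWswap : ∫⁻ p : (ℝ × ℝ) × (ℝ × ℝ), W p.swap < ∞ := by
    have := Measure.measurePreserving_swap (μ := (volume : Measure (ℝ × ℝ)))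
      (ν := (volume : Measure (ℝ × ℝ)))
    rw [← Measure.volume_eq_prod] at this
    rw [this.lintegral_comp mW]; exact hW
  have conv : ∀ C x₁ a b c α β γ : ℝ, 0 < C → 0 < x₁ → x₁ < t → 0 < a → a < t → 0 < b → b < t →
      0 < c → c < t → ENNReal.ofReal (C * (a ^ α * b ^ β * c ^ γ)) = ENNReal.ofReal C *
        (powWeight t 0 x₁ * (powWeight t α a * (powWeight t β b * powWeight t γ c))) := by
    intro C x₁ a b c α β γ hC hx hxt ha hat hb hbt hc hct
    rw [powWeight_of_mem hx hxt, powWeight_of_mem ha hat, powWeight_of_mem hb hbt,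
      powWeight_of_mem hc hct, Real.rpow_zero, ENNReal.ofReal_one, one_mul,
      ENNReal.ofReal_mul hC.le, ENNReal.ofReal_mul (by positivity),
      ENNReal.ofReal_mul (by positivity), mul_assoc (ENNReal.ofReal (a ^ α))]
  have bound : ∀ r s u v : ℝ, 0 < r → r < s → s < t → 0 < u → u < v → v < t → r < u →
      s ≠ u → s ≠ v →
      ENNReal.ofReal (gramMajorant H N n e r s u v) ≤ W1 r s u v + W2 r s u v + W3 r s u v := by
    intro r s u v hr hrs hst hu huv hvt hru hsu hsv
    rcases lt_or_gt_of_ne hsu with h | h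
    · refine le_trans ?_ le_add_self
      refine (ENNReal.ofReal_le_ofReal (b3 r s u v hrs h huv)).trans (le_of_eq ?_)
      exact conv _ r _ _ _ _ _ _ hC3 hr (by linarith) (by linarith) (by linarith) (by linarith)
        (by linarith) (by linarith) (by linarith)
    · refine le_trans ?_ le_self_add
      rcases lt_or_gt_of_ne hsv with h' | h'
      · refine le_trans ?_ le_self_add
        refine (ENNReal.ofReal_le_ofReal (b1 r u s v hru h h')).trans (le_of_eq ?_)
        exact conv _ r _ _ _ _ _ _ hC1 hr (by linarith) (by linarith) (by linarith) (by linarith)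
          (by linarith) (by linarith) (by linarith)
      · refine le_trans ?_ le_add_self
        refine (ENNReal.ofReal_le_ofReal (b2 r u v s hru huv h' (by linarith))).trans (le_of_eq ?_)
        exact conv _ r _ _ _ _ _ _ hC2 hr (by linarith) (by linarith) (by linarith) (by linarith)
          (by linarith) (by linarith) (by linarith)
  refine ⟨hm.aestronglyMeasurable, ?_⟩
  rw [hasFiniteIntegral_iff_ofReal (ae_of_all _ fun p => gramMajorant_nonneg h0 h1 _ _ _ _ _ _ _)]
  calc _ ≤ ∫⁻ p in timeSimplex t ×ˢ timeSimplex t, (W p + W p.swap) := by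
        refine lintegral_mono_ae ?_
        filter_upwards [ae_restrict_mem hS, ae_restrict_of_ae ae_times_ne] with p hp hne
        obtain ⟨⟨hr, hrs, hst⟩, ⟨hu, huv, hvt⟩⟩ := hp
        obtain ⟨n1, n2, n3, n4⟩ := hne
        rcases lt_or_gt_of_ne n1 with h | h
        · exact (bound _ _ _ _ hr hrs hst hu huv hvt h n3 n4).trans le_self_add
        · rw [gramMajorant_comm]
          exact (bound _ _ _ _ hu huv hvt hr hrs hst h n2.symm n4.symm).trans le_add_self
    _ ≤ ∫⁻ p, (W p + W p.swap) := setLIntegral_le_lintegral _ _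
    _ < ∞ := by
        rw [lintegral_add_left mW]
        exact ENNReal.add_lt_top.2 ⟨hW, hWswap⟩

/-! ### Mixed moments of Gaussian weights -/

/-- The unnormalised Gaussian moments `∫ x ^ n * exp (-x ^ 2 / 2) dx`. -/
noncomputable def gaussMoment (n : ℕ) : ℝ := ∫ x : ℝ, x ^ n * Real.exp (-x ^ 2 / 2)

lemma integrable_pow_mul_exp_neg_sq {a : ℝ} (ha : 0 < a) (n : ℕ) :
    Integrable fun x : ℝ => x ^ n * Real.exp (-a * x ^ 2 / 2) := by
  have := integrable_rpow_mul_exp_neg_mul_sq (b := a / 2) (by linarith) (s := n)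
    (by have := n.cast_nonneg (α := ℝ); linarith)
  refine this.congr (ae_of_all _ fun x => ?_)
  simp only [Real.rpow_natCast]
  congr 2; ring

lemma gaussMoment_odd {n : ℕ} (hn : Odd n) : gaussMoment n = 0 := by
  have h : gaussMoment n = -gaussMoment n := by
    unfold gaussMoment
    nth_rewrite 1 [← integral_neg_eq_self]
    rw [← integral_neg]
    congr 1; ext x
    rw [hn.neg_pow, neg_sq]; ring
  linarith

lemma integral_pow_mul_exp_neg_sq {a : ℝ} (ha : 0 < a) (n : ℕ) :
    ∫ x : ℝ, x ^ n * Real.exp (-a * x ^ 2 / 2) = gaussMoment n * (√a)⁻¹ ^ (n + 1) := by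
  have hs : 0 < √a := Real.sqrt_pos.2 ha
  have h := Measure.integral_comp_mul_left (fun x : ℝ => x ^ n * Real.exp (-x ^ 2 / 2)) (√a)
  rw [abs_of_pos (inv_pos.2 hs), smul_eq_mul] at h
  have e : ∀ x : ℝ, (√a * x) ^ n * Real.exp (-(√a * x) ^ 2 / 2)
      = √a ^ n * (x ^ n * Real.exp (-a * x ^ 2 / 2)) := by
    intro x
    rw [mul_pow, mul_pow, Real.sq_sqrt ha.le, neg_mul]; ring
  simp_rw [e] at h
  rw [integral_const_mul] at h
  change _ = (√a)⁻¹ * gaussMoment n at h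
  rw [pow_succ, inv_pow]
  field_simp
  rw [mul_comm] at h
  field_simp at h
  linarith

lemma integral_pow_mul_exp_linear {a : ℝ} (ha : 0 < a) (c : ℝ) (k : ℕ) :
    ∫ x : ℝ, x ^ k * Real.exp (-a * x ^ 2 / 2 - c * x)
      = Real.exp (c ^ 2 / (2 * a)) * ∑ j ∈ Finset.range (k + 1),
        (-c / a) ^ j * (k.choose j) * (gaussMoment (k - j) * (√a)⁻¹ ^ (k - j + 1)) := by
  -- complete the square
  rw [← integral_add_left_eq_self _ (-c / a)]
  have e : ∀ x : ℝ, (-c / a + x) ^ k * Real.exp (-a * (-c / a + x) ^ 2 / 2 - c * (-c / a + x))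
      = Real.exp (c ^ 2 / (2 * a)) * ∑ j ∈ Finset.range (k + 1),
        (-c / a) ^ j * (k.choose j) * (x ^ (k - j) * Real.exp (-a * x ^ 2 / 2)) := by
    intro x
    have e1 : -a * (-c / a + x) ^ 2 / 2 - c * (-c / a + x)
        = c ^ 2 / (2 * a) + -a * x ^ 2 / 2 := by
      field_simp; ring
    rw [e1, Real.exp_add, add_pow, Finset.sum_mul, Finset.mul_sum]
    refine Finset.sum_congr rfl fun j _ => ?_
    ring
  simp_rw [e]
  rw [integral_const_mul, integral_finsetSum _ fun j _ =>
    (integrable_pow_mul_exp_neg_sq ha (k - j)).const_mul _]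
  simp_rw [integral_const_mul, integral_pow_mul_exp_neg_sq ha]

/-- The value of `∫∫ x ^ k * y ^ k * exp (-(a x² + b y²) / 2 - m x y) dx dy` for `a > 0` and
`D = a b - m² > 0`; it depends on `a` and `b` only through `D`. -/
noncomputable def mixedMoment (k : ℕ) (m D : ℝ) : ℝ :=
  ∑ j ∈ Finset.range (k + 1),
    (k.choose j) * gaussMoment (k - j) * gaussMoment (k + j) * ((-m) ^ j * (√D)⁻¹ ^ (k + j + 1))

lemma integral_mixed_gaussian {a b m : ℝ} (ha : 0 < a) (hD : 0 < a * b - m ^ 2) (k : ℕ)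
    (hint : Integrable fun z : ℝ × ℝ =>
      z.1 ^ k * z.2 ^ k * Real.exp (-(a * z.1 ^ 2 + 2 * m * (z.1 * z.2) + b * z.2 ^ 2) / 2)) :
    ∫ z : ℝ × ℝ, z.1 ^ k * z.2 ^ k *
        Real.exp (-(a * z.1 ^ 2 + 2 * m * (z.1 * z.2) + b * z.2 ^ 2) / 2)
      = mixedMoment k m (a * b - m ^ 2) := by
  rw [Measure.volume_eq_prod] at hint ⊢
  rw [integral_prod_symm _ hint]
  have hc : 0 < (a * b - m ^ 2) / a := by positivity
  have e : ∀ y : ℝ, ∫ x : ℝ, x ^ k * y ^ k *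
        Real.exp (-(a * x ^ 2 + 2 * m * (x * y) + b * y ^ 2) / 2)
      = ∑ j ∈ Finset.range (k + 1), ((-m / a) ^ j * (k.choose j) *
        (gaussMoment (k - j) * (√a)⁻¹ ^ (k - j + 1))) *
        (y ^ (k + j) * Real.exp (-((a * b - m ^ 2) / a) * y ^ 2 / 2)) := by
    intro y
    have e1 : ∀ x : ℝ, x ^ k * y ^ k *
        Real.exp (-(a * x ^ 2 + 2 * m * (x * y) + b * y ^ 2) / 2)
        = (y ^ k * Real.exp (-(b * y ^ 2) / 2)) *
          (x ^ k * Real.exp (-a * x ^ 2 / 2 - (m * y) * x)) := by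
      intro x
      rw [show -(a * x ^ 2 + 2 * m * (x * y) + b * y ^ 2) / 2
        = -(b * y ^ 2) / 2 + (-a * x ^ 2 / 2 - (m * y) * x) by ring, Real.exp_add]
      ring
    simp_rw [e1]
    rw [integral_const_mul, integral_pow_mul_exp_linear ha, Finset.mul_sum, Finset.mul_sum]
    refine Finset.sum_congr rfl fun j _ => ?_
    have e2 : Real.exp (-((a * b - m ^ 2) / a) * y ^ 2 / 2)
        = Real.exp (-(b * y ^ 2) / 2) * Real.exp ((m * y) ^ 2 / (2 * a)) := by
      rw [← Real.exp_add]; congr 1; field_simp; ring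
    rw [e2, pow_add, show -(m * y) / a = (-m / a) * y by ring, mul_pow]
    ring
  simp_rw [e]
  rw [integral_finsetSum _ fun j _ => (integrable_pow_mul_exp_neg_sq hc (k + j)).const_mul _]
  unfold mixedMoment
  refine Finset.sum_congr rfl fun j hj => ?_
  rw [integral_const_mul, integral_pow_mul_exp_neg_sq hc, Real.sqrt_div' _ ha.le]
  have hs : 0 < √a := Real.sqrt_pos.2 ha
  have hD' : 0 < √(a * b - m ^ 2) := Real.sqrt_pos.2 hD
  have hjk : j ≤ k := Nat.lt_succ_iff.1 (Finset.mem_range.1 hj)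
  obtain ⟨i, rfl⟩ := Nat.exists_eq_add_of_le hjk
  rw [show j + i - j = i by omega]
  have ea : a = √a ^ 2 := (Real.sq_sqrt ha.le).symm
  have e3 : (-m / a) ^ j * (√a)⁻¹ ^ (i + 1) * (√(a * b - m ^ 2) / √a)⁻¹ ^ (j + i + j + 1)
      = (-m) ^ j * (√(a * b - m ^ 2))⁻¹ ^ (j + i + j + 1) := by
    rw [inv_div, div_pow, div_pow, inv_pow, inv_pow]
    have e4 : a ^ j * √a ^ (i + 1) = √a ^ (j + i + j + 1) := by
      nth_rewrite 1 [ea]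
      rw [← pow_mul, ← pow_add]; congr 1; ring
    have h1 : √a ^ (i + 1) ≠ 0 := by positivity
    have h2 : a ^ j ≠ 0 := by positivity
    have h3 : √(a * b - m ^ 2) ^ (j + i + j + 1) ≠ 0 := by positivity
    rw [← e4]
    field_simp
  linear_combination ((j + i).choose j * gaussMoment i * gaussMoment (j + i + j)) * e3

lemma continuousAt_mixedMoment (k : ℕ) (m : ℝ) {D : ℝ} (hD : 0 < D) :
    ContinuousAt (mixedMoment k m) D := by
  unfold mixedMoment
  have h : √D ≠ 0 := (Real.sqrt_pos.2 hD).ne'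
  refine tendsto_finsetSum _ fun j _ => ?_
  refine ContinuousAt.mul continuousAt_const (ContinuousAt.mul continuousAt_const ?_)
  exact (Real.continuous_sqrt.continuousAt.inv₀ h).pow _

/-- The sum of the absolute values of the coefficients of `mixedMoment k`. -/
noncomputable def mixedMomentConst (k : ℕ) : ℝ :=
  ∑ j ∈ Finset.range (k + 1), |(k.choose j) * gaussMoment (k - j) * gaussMoment (k + j)|

/-- By parity, only powers `m ^ j` with `j ≡ k mod 2` occur; hence the factor `|m|` for odd `k`. -/
lemma abs_mixedMoment_le (k : ℕ) {m D₀ D L : ℝ} (h0 : 0 < D₀) (hD : D₀ ≤ D) (hm : m ^ 2 ≤ L)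
    (hL : D₀ ≤ L) :
    |mixedMoment k m D| ≤ mixedMomentConst k *
      (|m| ^ (k % 2) * L ^ (k / 2) * D₀ ^ (-(k + 1 / 2 : ℝ))) := by
  unfold mixedMoment mixedMomentConst
  rw [Finset.sum_mul]
  refine (Finset.abs_sum_le_sum_abs _ _).trans (Finset.sum_le_sum fun j hj => ?_)
  rw [abs_mul]
  by_cases hpar : Odd (k - j)
  · rw [gaussMoment_odd hpar]; simp
  refine mul_le_mul_of_nonneg_left ?_ (abs_nonneg _)
  have hjk : j ≤ k := Nat.lt_succ_iff.1 (Finset.mem_range.1 hj)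
  obtain ⟨i, hi⟩ := Nat.not_odd_iff_even.1 hpar
  obtain ⟨l, hl⟩ : ∃ l, j = 2 * l + k % 2 := ⟨j / 2, by omega⟩
  have hk2 : k / 2 = l + i := by omega
  have hL0 : 0 ≤ L := h0.le.trans hL
  have hs0 : 0 < √D₀ := Real.sqrt_pos.2 h0
  have hs : √D₀ ≤ √D := Real.sqrt_le_sqrt hD
  have e1 : D₀ ^ (-(k + 1 / 2 : ℝ)) = (√D₀)⁻¹ ^ (2 * k + 1) := by
    rw [Real.sqrt_eq_rpow, ← Real.rpow_neg h0.le, ← Real.rpow_natCast, ← Real.rpow_mul h0.le]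
    congr 1; push_cast; ring
  have e2 : (√D₀)⁻¹ ^ (k + j + 1) = D₀ ^ i * (√D₀)⁻¹ ^ (2 * k + 1) := by
    have : 2 * k + 1 = (k + j + 1) + 2 * i := by omega
    rw [this, pow_add _ (k + j + 1), pow_mul, inv_pow _ 2, Real.sq_sqrt h0.le, inv_pow _ i]
    field_simp
  have e3 : |m| ^ j = |m| ^ (k % 2) * (m ^ 2) ^ l := by
    nth_rewrite 1 [hl]
    rw [pow_add, pow_mul, sq_abs, mul_comm]
  rw [abs_mul, abs_pow, abs_neg, abs_of_nonneg (by positivity : 0 ≤ (√D)⁻¹ ^ (k + j + 1)), e1, hk2]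
  calc |m| ^ j * (√D)⁻¹ ^ (k + j + 1) ≤ |m| ^ j * (√D₀)⁻¹ ^ (k + j + 1) := by gcongr
    _ = |m| ^ (k % 2) * ((m ^ 2) ^ l * D₀ ^ i) * (√D₀)⁻¹ ^ (2 * k + 1) := by rw [e2, e3]; ring
    _ ≤ |m| ^ (k % 2) * (L ^ l * L ^ i) * (√D₀)⁻¹ ^ (2 * k + 1) := by gcongr
    _ = _ := by rw [← pow_add]

lemma integral_euclidean_prod_eq_prod {d : ℕ} (φ : Fin d → ℝ × ℝ → ℝ) :
    ∫ z : EuclideanSpace ℝ (Fin d) × EuclideanSpace ℝ (Fin d), ∏ i, φ i (z.1 i, z.2 i)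
      = ∏ i, ∫ y, φ i y := by
  have h1 : MeasurePreserving (Prod.map (WithLp.ofLp (p := 2) (V := Fin d → ℝ))
      (WithLp.ofLp (p := 2) (V := Fin d → ℝ))) := by
    have := (PiLp.volume_preserving_ofLp (ι := Fin d))
    exact this.prod this
  have h2 := (volume_measurePreserving_arrowProdEquivProdArrow ℝ ℝ (Fin d)).symm
  have h3 := h2.comp h1
  have he : MeasurableEmbedding ((MeasurableEquiv.arrowProdEquivProdArrow ℝ ℝ (Fin d)).symm ∘
      Prod.map (WithLp.ofLp (p := 2) (V := Fin d → ℝ)) (WithLp.ofLp (p := 2) (V := Fin d → ℝ))) :=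
    ((MeasurableEquiv.arrowProdEquivProdArrow ℝ ℝ (Fin d)).symm).measurableEmbedding.comp
      (((MeasurableEquiv.toLp 2 (Fin d → ℝ)).symm.prodCongr
        (MeasurableEquiv.toLp 2 (Fin d → ℝ)).symm).measurableEmbedding)
  have h4 := h3.integral_comp he (fun y : Fin d → ℝ × ℝ => ∏ i, φ i (y i))
  rw [← integral_fintype_prod_volume_eq_prod, ← h4]
  rfl

/-! ### The Fourier weight of the Gaussian kernel -/

/-- The Fourier weight `p₁ ^ k₁ ⋯ p_d ^ k_d * exp (-ε |p|² / 2)` of `gaussianKernelDeriv k ε`. -/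
noncomputable def kernelWeight {d : ℕ} (k : Fin d → ℕ) (ε : ℝ) (p : EuclideanSpace ℝ (Fin d)) : ℝ :=
  (∏ i, p i ^ k i) * Real.exp (-ε * ‖p‖ ^ 2 / 2)

lemma kernelWeight_eq_prod {d : ℕ} (k : Fin d → ℕ) (ε : ℝ) (p : EuclideanSpace ℝ (Fin d)) :
    kernelWeight k ε p = ∏ i, (p i ^ k i * Real.exp (-ε * p i ^ 2 / 2)) := by
  unfold kernelWeight
  rw [Finset.prod_mul_distrib, ← Real.exp_sum, EuclideanSpace.real_norm_sq_eq, Finset.mul_sum,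
    Finset.sum_div]

lemma integrable_kernelWeight {d : ℕ} (k : Fin d → ℕ) {ε : ℝ} (hε : 0 < ε) :
    Integrable (kernelWeight k ε) := by
  have h : Integrable fun x : Fin d → ℝ => ∏ i, (x i ^ k i * Real.exp (-ε * x i ^ 2 / 2)) :=
    Integrable.fintype_prod fun i => integrable_pow_mul_exp_neg_sq hε (k i)
  have h2 := (PiLp.volume_preserving_ofLp (Fin d)).integrable_comp_of_integrable h
  refine h2.congr (ae_of_all _ fun p => ?_)
  simp only [Function.comp]
  rw [kernelWeight_eq_prod]

lemma gaussianKernelDeriv_eq {d : ℕ} (k : Fin d → ℕ) (ε : ℝ) (x : EuclideanSpace ℝ (Fin d)) :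
    gaussianKernelDeriv k ε x = Complex.I ^ multiOrder k / ((2 * Real.pi : ℝ) : ℂ) ^ d *
      ∫ p : EuclideanSpace ℝ (Fin d), (kernelWeight k ε p : ℂ) *
        Complex.exp (Complex.I * ((inner ℝ p x : ℝ) : ℂ)) := by
  unfold gaussianKernelDeriv kernelWeight
  congr 2
  ext p
  push_cast
  ring

lemma norm_exp_I_mul_ofReal (x : ℝ) : ‖Complex.exp (Complex.I * (x : ℂ))‖ = 1 := by
  rw [mul_comm, Complex.norm_exp_ofReal_mul_I]

/-- The supremum bound for `gaussianKernelDeriv k ε` given by the `L¹` norm of its Fourier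
weight. -/
noncomputable def kernelBound {d : ℕ} (k : Fin d → ℕ) (ε : ℝ) : ℝ :=
  ‖Complex.I ^ multiOrder k / ((2 * Real.pi : ℝ) : ℂ) ^ d‖ *
    ∫ p : EuclideanSpace ℝ (Fin d), |kernelWeight k ε p|

lemma norm_gaussianKernelDeriv_le {d : ℕ} (k : Fin d → ℕ) (ε : ℝ) (x : EuclideanSpace ℝ (Fin d)) :
    ‖gaussianKernelDeriv k ε x‖ ≤ kernelBound k ε := by
  rw [gaussianKernelDeriv_eq, norm_mul]
  refine mul_le_mul_of_nonneg_left ((norm_integral_le_integral_norm _).trans (le_of_eq ?_))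
    (norm_nonneg _)
  congr 1; ext p
  rw [norm_mul, norm_exp_I_mul_ofReal, mul_one, Complex.norm_real, Real.norm_eq_abs]

lemma measurable_kernelWeight {d : ℕ} (k : Fin d → ℕ) (ε : ℝ) : Measurable (kernelWeight k ε) := by
  unfold kernelWeight
  fun_prop

lemma measurable_gaussianKernelDeriv {d : ℕ} (k : Fin d → ℕ) (ε : ℝ) :
    Measurable (gaussianKernelDeriv (d := d) k ε) := by
  have e : gaussianKernelDeriv (d := d) k ε = fun x => _ := funext (gaussianKernelDeriv_eq k ε)
  rw [e]
  refine Measurable.const_mul ?_ _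
  refine StronglyMeasurable.measurable ?_
  refine StronglyMeasurable.integral_prod_right (f := fun (x p : EuclideanSpace ℝ (Fin d)) =>
    (kernelWeight k ε p : ℂ) * Complex.exp (Complex.I * ((inner ℝ p x : ℝ) : ℂ))) ?_
  refine Measurable.stronglyMeasurable ?_
  have := measurable_kernelWeight k ε
  unfold Function.uncurry
  fun_prop

/-- The kernel is real, by the substitution `p ↦ -p` in the Fourier integral. -/
lemma conj_gaussianKernelDeriv {d : ℕ} (k : Fin d → ℕ) (ε : ℝ) (x : EuclideanSpace ℝ (Fin d)) :
    (starRingEnd ℂ) (gaussianKernelDeriv k ε x) = gaussianKernelDeriv k ε x := by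
  rw [gaussianKernelDeriv_eq, map_mul, ← integral_conj]
  have e : ∫ p : EuclideanSpace ℝ (Fin d), (starRingEnd ℂ) ((kernelWeight k ε p : ℂ) *
        Complex.exp (Complex.I * ((inner ℝ p x : ℝ) : ℂ)))
      = (-1) ^ multiOrder k * ∫ p : EuclideanSpace ℝ (Fin d), (kernelWeight k ε p : ℂ) *
        Complex.exp (Complex.I * ((inner ℝ p x : ℝ) : ℂ)) := by
    rw [← integral_neg_eq_self, ← integral_const_mul]
    congr 1; ext p
    have h1 : kernelWeight k ε (-p) = (-1) ^ multiOrder k * kernelWeight k ε p := by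
      unfold kernelWeight multiOrder
      rw [norm_neg, ← Finset.prod_pow_eq_pow_sum, ← mul_assoc, ← Finset.prod_mul_distrib]
      congr 1
      refine Finset.prod_congr rfl fun i _ => ?_
      rw [PiLp.neg_apply, neg_pow]
    rw [map_mul, Complex.conj_ofReal, ← Complex.exp_conj, map_mul, Complex.conj_I,
      Complex.conj_ofReal, h1, inner_neg_left]
    push_cast
    rw [neg_mul_neg]; ring
  rw [e, ← mul_assoc]
  congr 1
  rw [map_div₀, map_pow, map_pow, Complex.conj_I, Complex.conj_ofReal, div_mul_eq_mul_div,
    ← mul_pow, neg_mul_neg, mul_one]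

/-! ### Characteristic function of two increments -/

lemma IsFractionalBrownianMotion.hasGaussianLaw_pairing {Ω : Type*} [MeasurableSpace Ω] {d : ℕ}
    {H : ℝ} {B : ℝ≥0 → Ω → EuclideanSpace ℝ (Fin d)} {P : Measure Ω}
    (hB : IsFractionalBrownianMotion H B P) (r s u v : ℝ≥0) (p q : EuclideanSpace ℝ (Fin d)) :
    HasGaussianLaw (fun ω => inner ℝ p (B s ω - B r ω) + inner ℝ q (B v ω - B u ω)) P := by
  classical
  have hY : IsGaussianProcess (fun (_ : Unit) ω =>
      inner ℝ p (B s ω - B r ω) + inner ℝ q (B v ω - B u ω)) P := by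
    refine hB.isGaussianProcess.of_isGaussianProcess fun _ => ⟨{r, s, u, v},
      (innerSL ℝ p) ∘L (.proj ⟨s, by simp⟩ - .proj ⟨r, by simp⟩)
        + (innerSL ℝ q) ∘L (.proj ⟨v, by simp⟩ - .proj ⟨u, by simp⟩), fun ω => ?_⟩
    simp [inner_sub_right]
  exact hY.hasGaussianLaw_eval ()

lemma IsFractionalBrownianMotion.memLp_coord {Ω : Type*} [MeasurableSpace Ω] {d : ℕ}
    {H : ℝ} {B : ℝ≥0 → Ω → EuclideanSpace ℝ (Fin d)} {P : Measure Ω}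
    (hB : IsFractionalBrownianMotion H B P) (t : ℝ≥0) (i : Fin d) :
    MemLp (fun ω => B t ω i) 2 P :=
  ((hB.isGaussianProcess.hasGaussianLaw_eval t).map_fun (EuclideanSpace.proj i)).memLp_two

lemma pairing_eq_sum {d : ℕ} (p q a b c e : EuclideanSpace ℝ (Fin d)) :
    inner ℝ p (b - a) + inner ℝ q (e - c) = ∑ x : Fin d × Fin 4,
      (![-p x.1, p x.1, -q x.1, q x.1] : Fin 4 → ℝ) x.2 *
        (![a, b, c, e] : Fin 4 → EuclideanSpace ℝ (Fin d)) x.2 x.1 := by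
  rw [Fintype.sum_prod_type]
  simp only [Fin.sum_univ_four, PiLp.inner_apply, ← Finset.sum_add_distrib]
  refine Finset.sum_congr rfl fun i _ => ?_
  simp
  ring

lemma IsFractionalBrownianMotion.integral_pairing {Ω : Type*} [MeasurableSpace Ω] {d : ℕ}
    {H : ℝ} {B : ℝ≥0 → Ω → EuclideanSpace ℝ (Fin d)} {P : Measure Ω} [IsProbabilityMeasure P]
    (hB : IsFractionalBrownianMotion H B P) (r s u v : ℝ≥0) (p q : EuclideanSpace ℝ (Fin d)) :
    ∫ ω, inner ℝ p (B s ω - B r ω) + inner ℝ q (B v ω - B u ω) ∂P = 0 := by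
  simp_rw [pairing_eq_sum]
  have hi : ∀ x : Fin d × Fin 4, (fun ω => (![B r ω, B s ω, B u ω, B v ω] :
      Fin 4 → EuclideanSpace ℝ (Fin d)) x.2 x.1) =
      fun ω => B ((![r, s, u, v] : Fin 4 → ℝ≥0) x.2) ω x.1 := by
    rintro ⟨i, j⟩; fin_cases j <;> rfl
  rw [integral_finsetSum]
  · refine Finset.sum_eq_zero fun x _ => ?_
    rw [integral_const_mul, hi, hB.centered, mul_zero]
  · intro x _
    refine Integrable.const_mul ?_ _
    rw [hi]
    exact (hB.memLp_coord _ _).integrable (by norm_num)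

lemma IsFractionalBrownianMotion.variance_pairing {Ω : Type*} [MeasurableSpace Ω] {d : ℕ}
    {H : ℝ} (h0 : 0 < H) {B : ℝ≥0 → Ω → EuclideanSpace ℝ (Fin d)} {P : Measure Ω}
    [IsProbabilityMeasure P]
    (hB : IsFractionalBrownianMotion H B P) (r s u v : ℝ≥0) (p q : EuclideanSpace ℝ (Fin d)) :
    variance (fun ω => inner ℝ p (B s ω - B r ω) + inner ℝ q (B v ω - B u ω)) P
      = |(s : ℝ) - r| ^ (2 * H) * ‖p‖ ^ 2 + 2 * incCov H r s u v * inner ℝ p q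
        + |(v : ℝ) - u| ^ (2 * H) * ‖q‖ ^ 2 := by
  simp_rw [pairing_eq_sum]
  have hi : ∀ x : Fin d × Fin 4, (fun ω => (![B r ω, B s ω, B u ω, B v ω] :
      Fin 4 → EuclideanSpace ℝ (Fin d)) x.2 x.1) =
      fun ω => B ((![r, s, u, v] : Fin 4 → ℝ≥0) x.2) ω x.1 := by
    rintro ⟨i, j⟩; fin_cases j <;> rfl
  rw [variance_fun_sum]
  · simp_rw [covariance_const_mul_left, covariance_const_mul_right, hi, hB.covariance_eq]
    simp_rw [Fintype.sum_prod_type, Fin.sum_univ_four]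
    simp only [Finset.sum_add_distrib, mul_ite, mul_zero, Finset.sum_ite_eq, Finset.mem_univ,
      if_true]
    rw [EuclideanSpace.real_norm_sq_eq, EuclideanSpace.real_norm_sq_eq, PiLp.inner_apply,
      Finset.mul_sum, Finset.mul_sum, Finset.mul_sum]
    simp only [← Finset.sum_add_distrib]
    refine Finset.sum_congr rfl fun i _ => ?_
    simp [Real.zero_rpow (show 2 * H ≠ 0 by positivity)]
    unfold incCov
    rw [abs_sub_comm (r : ℝ) s, abs_sub_comm (u : ℝ) r, abs_sub_comm (v : ℝ) r,
      abs_sub_comm (u : ℝ) s, abs_sub_comm (v : ℝ) s, abs_sub_comm (u : ℝ) v]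
    ring
  · intro x
    refine MemLp.const_mul ?_ _
    rw [hi]
    exact hB.memLp_coord _ _

/-- The joint characteristic function of two increments of fractional Brownian motion. -/
lemma IsFractionalBrownianMotion.integral_exp_pairing {Ω : Type*} [MeasurableSpace Ω] {d : ℕ}
    {H : ℝ} (h0 : 0 < H) {B : ℝ≥0 → Ω → EuclideanSpace ℝ (Fin d)} {P : Measure Ω}
    [IsProbabilityMeasure P]
    (hB : IsFractionalBrownianMotion H B P) (r s u v : ℝ≥0) (p q : EuclideanSpace ℝ (Fin d)) :
    ∫ ω, Complex.exp (Complex.I *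
        ((inner ℝ p (B s ω - B r ω) + inner ℝ q (B v ω - B u ω) : ℝ) : ℂ)) ∂P
      = (Real.exp (-(|(s : ℝ) - r| ^ (2 * H) * ‖p‖ ^ 2 + 2 * incCov H r s u v * inner ℝ p q
        + |(v : ℝ) - u| ^ (2 * H) * ‖q‖ ^ 2) / 2) : ℂ) := by
  have hG := hB.hasGaussianLaw_pairing r s u v p q
  have h := hG.charFun_map_eq 1
  rw [charFun_apply_real, integral_map hG.aemeasurable (by fun_prop)] at h
  have e1 : ∀ x : ℝ, inner ℝ (1 : ℝ) x = x := fun x => by simp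
  simp_rw [e1] at h
  rw [hB.integral_pairing, hB.variance_pairing h0] at h
  convert! h using 1
  · congr 1; ext ω; congr 1; push_cast; ring
  · push_cast; congr 1; ring

/-! ### Second moments of the kernels -/

lemma quadratic_form_nonneg {l r m : ℝ} (hl : 0 ≤ l) (hr : 0 ≤ r) (h : m ^ 2 ≤ l * r) (x y : ℝ) :
    0 ≤ l * x ^ 2 + 2 * m * (x * y) + r * y ^ 2 := by
  rcases hl.eq_or_lt with h0 | h0
  · rw [← h0, zero_mul] at h
    have : m = 0 := by nlinarith
    rw [← h0, this]; nlinarith [mul_nonneg hr (sq_nonneg y)]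
  · have h1 : 0 ≤ l * (l * x ^ 2 + 2 * m * (x * y) + r * y ^ 2) := by
      have := mul_nonneg (sub_nonneg.2 h) (sq_nonneg y)
      nlinarith [sq_nonneg (l * x + m * y)]
    exact nonneg_of_mul_nonneg_right h1 h0

lemma integrable_mixed_gaussian {l r m ε η : ℝ} (hl : 0 ≤ l) (hr : 0 ≤ r) (h : m ^ 2 ≤ l * r)
    (hε : 0 < ε) (hη : 0 < η) (k : ℕ) :
    Integrable fun z : ℝ × ℝ => z.1 ^ k * z.2 ^ k *
      Real.exp (-((l + ε) * z.1 ^ 2 + 2 * m * (z.1 * z.2) + (r + η) * z.2 ^ 2) / 2) := by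
  have hi := (integrable_pow_mul_exp_neg_sq hε k).mul_prod (integrable_pow_mul_exp_neg_sq hη k)
  rw [← Measure.volume_eq_prod] at hi
  refine hi.mono (Measurable.aestronglyMeasurable (by fun_prop)) (ae_of_all _ fun z => ?_)
  simp only [norm_mul, Real.norm_eq_abs, Real.abs_exp]
  have h1 := quadratic_form_nonneg hl hr h z.1 z.2
  have h2 : Real.exp (-((l + ε) * z.1 ^ 2 + 2 * m * (z.1 * z.2) + (r + η) * z.2 ^ 2) / 2)
      ≤ Real.exp (-ε * z.1 ^ 2 / 2) * Real.exp (-η * z.2 ^ 2 / 2) := by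
    rw [← Real.exp_add]; exact Real.exp_le_exp.2 (by linarith)
  calc _ ≤ |z.1 ^ k| * |z.2 ^ k| * (Real.exp (-ε * z.1 ^ 2 / 2) * Real.exp (-η * z.2 ^ 2 / 2)) := by
        gcongr
    _ = _ := by ring

/-- The second moment of two kernels along a centered Gaussian vector `(X, Y)` with covariance
blocks `l • 1`, `m • 1` and `r • 1`. -/
lemma integral_gaussianKernelDeriv_mul {Ω : Type*} [MeasurableSpace Ω] {P : Measure Ω}
    [IsProbabilityMeasure P] {d : ℕ} {X Y : Ω → EuclideanSpace ℝ (Fin d)} (hX : AEMeasurable X P)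
    (hY : AEMeasurable Y P) {l r m : ℝ} (hl : 0 ≤ l) (hr : 0 ≤ r) (h : m ^ 2 ≤ l * r)
    (hchar : ∀ p q : EuclideanSpace ℝ (Fin d),
      ∫ ω, Complex.exp (Complex.I * ((inner ℝ p (X ω) + inner ℝ q (Y ω) : ℝ) : ℂ)) ∂P
        = (Real.exp (-(l * ‖p‖ ^ 2 + 2 * m * inner ℝ p q + r * ‖q‖ ^ 2) / 2) : ℂ))
    (k : Fin d → ℕ) {ε η : ℝ} (hε : 0 < ε) (hη : 0 < η) :
    ∫ ω, gaussianKernelDeriv k ε (X ω) * gaussianKernelDeriv k η (Y ω) ∂P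
      = (Complex.I ^ multiOrder k / ((2 * Real.pi : ℝ) : ℂ) ^ d) ^ 2 *
        ((∏ i, mixedMoment (k i) m ((l + ε) * (r + η) - m ^ 2) : ℝ) : ℂ) := by
  set c : ℂ := Complex.I ^ multiOrder k / ((2 * Real.pi : ℝ) : ℂ) ^ d with hc
  let F : Ω → EuclideanSpace ℝ (Fin d) × EuclideanSpace ℝ (Fin d) → ℂ := fun ω z =>
    ((kernelWeight k ε z.1 : ℂ) * Complex.exp (Complex.I * ((inner ℝ z.1 (X ω) : ℝ) : ℂ))) *
    ((kernelWeight k η z.2 : ℂ) * Complex.exp (Complex.I * ((inner ℝ z.2 (Y ω) : ℝ) : ℂ)))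
  have e1 : ∀ ω, gaussianKernelDeriv k ε (X ω) * gaussianKernelDeriv k η (Y ω)
      = c ^ 2 * ∫ z, F ω z := by
    intro ω
    rw [gaussianKernelDeriv_eq, gaussianKernelDeriv_eq, Measure.volume_eq_prod]
    change _ = c ^ 2 * ∫ z : EuclideanSpace ℝ (Fin d) × EuclideanSpace ℝ (Fin d),
      ((kernelWeight k ε z.1 : ℂ) * Complex.exp (Complex.I * ((inner ℝ z.1 (X ω) : ℝ) : ℂ))) *
      ((kernelWeight k η z.2 : ℂ) * Complex.exp (Complex.I * ((inner ℝ z.2 (Y ω) : ℝ) : ℂ)))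
        ∂(volume.prod volume)
    rw [integral_prod_mul (fun p : EuclideanSpace ℝ (Fin d) => (kernelWeight k ε p : ℂ) *
        Complex.exp (Complex.I * ((inner ℝ p (X ω) : ℝ) : ℂ)))
      (fun q : EuclideanSpace ℝ (Fin d) => (kernelWeight k η q : ℂ) *
        Complex.exp (Complex.I * ((inner ℝ q (Y ω) : ℝ) : ℂ)))]
    ring
  simp_rw [e1]
  rw [integral_const_mul]
  congr 1
  have m1 := measurable_kernelWeight k ε
  have m2 := measurable_kernelWeight k η
  have hint : Integrable (Function.uncurry F) (P.prod volume) := by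
    have hw : Integrable (fun z : EuclideanSpace ℝ (Fin d) × EuclideanSpace ℝ (Fin d) =>
        kernelWeight k ε z.1 * kernelWeight k η z.2) := by
      rw [Measure.volume_eq_prod]
      exact (integrable_kernelWeight k hε).mul_prod (integrable_kernelWeight k hη)
    refine (hw.comp_snd P).mono ?_ (ae_of_all _ fun z => ?_)
    · have hX' : AEMeasurable (fun z : Ω × (EuclideanSpace ℝ (Fin d) × EuclideanSpace ℝ (Fin d)) =>
          X z.1) (P.prod volume) := hX.comp_fst
      have hY' : AEMeasurable (fun z : Ω × (EuclideanSpace ℝ (Fin d) × EuclideanSpace ℝ (Fin d)) =>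
          Y z.1) (P.prod volume) := hY.comp_fst
      refine AEMeasurable.aestronglyMeasurable ?_
      have hs : Measurable fun z : Ω × (EuclideanSpace ℝ (Fin d) × EuclideanSpace ℝ (Fin d)) =>
          z.2 := measurable_snd
      have i1 := (hs.fst.aemeasurable (μ := P.prod volume)).inner (𝕜 := ℝ) hX'
      have i2 := (hs.snd.aemeasurable (μ := P.prod volume)).inner (𝕜 := ℝ) hY'
      unfold F Function.uncurry
      fun_prop
    · simp only [Function.uncurry, F, norm_mul, norm_exp_I_mul_ofReal, Complex.norm_real, mul_one]
      exact le_rfl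
  rw [integral_integral_swap hint]
  have e2 : ∀ z : EuclideanSpace ℝ (Fin d) × EuclideanSpace ℝ (Fin d), ∫ ω, F ω z ∂P
      = ((∏ i, (z.1 i ^ k i * z.2 i ^ k i * Real.exp (-((l + ε) * z.1 i ^ 2
        + 2 * m * (z.1 i * z.2 i) + (r + η) * z.2 i ^ 2) / 2)) : ℝ) : ℂ) := by
    intro z
    have e3 : ∀ ω, F ω z = ((kernelWeight k ε z.1 * kernelWeight k η z.2 : ℝ) : ℂ) *
        Complex.exp (Complex.I * ((inner ℝ z.1 (X ω) + inner ℝ z.2 (Y ω) : ℝ) : ℂ)) := by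
      intro ω
      simp only [F]
      push_cast
      rw [mul_add, Complex.exp_add]; ring
    simp_rw [e3]
    rw [integral_const_mul, hchar, ← Complex.ofReal_mul]
    congr 1
    rw [kernelWeight_eq_prod, kernelWeight_eq_prod, ← Finset.prod_mul_distrib,
      EuclideanSpace.real_norm_sq_eq, EuclideanSpace.real_norm_sq_eq, PiLp.inner_apply,
      Finset.mul_sum, Finset.mul_sum, Finset.mul_sum, ← Finset.sum_add_distrib,
      ← Finset.sum_add_distrib, ← Finset.sum_neg_distrib, Finset.sum_div, Real.exp_sum,
      ← Finset.prod_mul_distrib]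
    refine Finset.prod_congr rfl fun i _ => ?_
    simp only [RCLike.inner_apply, conj_trivial]
    rw [show -((l + ε) * z.1 i ^ 2 + 2 * m * (z.1 i * z.2 i) + (r + η) * z.2 i ^ 2) / 2
      = -ε * z.1 i ^ 2 / 2 + -η * z.2 i ^ 2 / 2 +
        -(l * z.1 i ^ 2 + 2 * m * (z.2 i * z.1 i) + r * z.2 i ^ 2) / 2 by ring, Real.exp_add,
      Real.exp_add]
    ring
  simp_rw [e2]
  rw [integral_complex_ofReal]
  congr 1
  rw [integral_euclidean_prod_eq_prod (fun i y => y.1 ^ k i * y.2 ^ k i *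
    Real.exp (-((l + ε) * y.1 ^ 2 + 2 * m * (y.1 * y.2) + (r + η) * y.2 ^ 2) / 2))]
  refine Finset.prod_congr rfl fun i _ => ?_
  refine integral_mixed_gaussian (by linarith) ?_ (k i)
    (integrable_mixed_gaussian hl hr h hε hη (k i))
  nlinarith [mul_nonneg hl hη.le, mul_nonneg hε.le hr, mul_pos hε hη]

/-! ### A Cauchy criterion in `L²` -/

/-- If the inner products `∫ A ε * A η` converge as `(ε, η)` tends to the limit point jointly, then
`A ε` converges in `L²`. -/
lemma exists_tendsto_eLpNorm_of_tendsto_integral_mul {Ω ι : Type*} [MeasurableSpace Ω]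
    {P : Measure Ω} {l : Filter ι} [l.NeBot] {A : ι → Ω → ℝ} (hA : ∀ᶠ ε in l, MemLp (A ε) 2 P)
    {L : ℝ} (hL : Tendsto (fun z : ι × ι => ∫ ω, A z.1 ω * A z.2 ω ∂P) (l ×ˢ l) (𝓝 L)) :
    ∃ α : Ω → ℝ, MemLp α 2 P ∧ Tendsto (fun ε => eLpNorm (fun ω => A ε ω - α ω) 2 P) l (𝓝 0) := by
  classical
  let U : ι → Lp ℝ 2 P := fun ε => if h : MemLp (A ε) 2 P then h.toLp else 0
  have hU : ∀ ε, MemLp (A ε) 2 P → U ε =ᵐ[P] A ε := by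
    intro ε h
    simp only [U, dif_pos h]
    exact h.coeFn_toLp
  have hin : Tendsto (fun z : ι × ι => inner ℝ (U z.1) (U z.2)) (l ×ˢ l) (𝓝 L) := by
    refine hL.congr' ?_
    filter_upwards [hA.prod_mk hA] with z hz
    rw [L2.inner_def]
    refine integral_congr_ae ?_
    filter_upwards [hU _ hz.1, hU _ hz.2] with ω h1 h2
    rw [h1, h2]
    simp [mul_comm]
  have h11 := hin.comp ((tendsto_fst (f := l) (g := l)).prodMk (tendsto_fst (f := l) (g := l)))
  have h22 := hin.comp ((tendsto_snd (f := l) (g := l)).prodMk (tendsto_snd (f := l) (g := l)))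
  have hsq : Tendsto (fun z : ι × ι => ‖U z.1 - U z.2‖ ^ 2) (l ×ˢ l) (𝓝 0) := by
    have h3 := (h11.sub (hin.const_mul 2)).add h22
    have h0 : L - 2 * L + L = 0 := by ring
    rw [h0] at h3
    refine h3.congr fun z => ?_
    simp only [Function.comp]
    rw [norm_sub_sq_real, real_inner_self_eq_norm_sq, real_inner_self_eq_norm_sq]
  have hdist : Tendsto (fun z : ι × ι => dist (U z.1) (U z.2)) (l ×ˢ l) (𝓝 0) := by
    have h4 := hsq.sqrt
    rw [Real.sqrt_zero] at h4
    refine h4.congr fun z => ?_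
    rw [Real.sqrt_sq (norm_nonneg _), dist_eq_norm]
  have hC : Cauchy (map U l) := by
    rw [cauchy_map_iff']
    exact tendsto_uniformity_iff_dist_tendsto_zero.2 hdist
  obtain ⟨x, hx⟩ := CompleteSpace.complete hC
  refine ⟨x, Lp.memLp x, ?_⟩
  have hx' : Tendsto U l (𝓝 x) := hx
  rw [tendsto_iff_edist_tendsto_0] at hx'
  refine hx'.congr' ?_
  filter_upwards [hA] with ε hε
  rw [Lp.edist_def]
  exact eLpNorm_congr_ae ((hU ε hε).sub (ae_eq_refl _))

/-! ### The approximations as random variables -/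

lemma volume_timeSimplex_lt_top (t : ℝ) : volume (timeSimplex t) < ∞ := by
  have hsub : timeSimplex t ⊆ Set.Icc 0 t ×ˢ Set.Icc 0 t := by
    rintro q ⟨h1, h2, h3⟩
    exact ⟨⟨h1.le, (h2.trans h3).le⟩, ⟨(h1.trans h2).le, h3.le⟩⟩
  refine (measure_mono hsub).trans_lt ?_
  exact (isCompact_Icc.prod isCompact_Icc).measure_lt_top

lemma MeasureTheory.AEStronglyMeasurable.mul_fst_snd {Ω α : Type*} [MeasurableSpace Ω]
    [MeasurableSpace α] {P : Measure Ω} [SFinite P] {V : Measure α} [SFinite V] {f g : Ω × α → ℂ}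
    (hf : AEStronglyMeasurable f (P.prod V)) (hg : AEStronglyMeasurable g (P.prod V)) :
    AEStronglyMeasurable (fun z : Ω × (α × α) => f (z.1, z.2.1) * g (z.1, z.2.2))
      (P.prod (V.prod V)) :=
  (hf.comp_quasiMeasurePreserving (QuasiMeasurePreserving.prodMap
    (Measure.QuasiMeasurePreserving.id P) Measure.quasiMeasurePreserving_fst)).mul
  (hg.comp_quasiMeasurePreserving (QuasiMeasurePreserving.prodMap
    (Measure.QuasiMeasurePreserving.id P) Measure.quasiMeasurePreserving_snd))

lemma norm_dsltIntegrand_le {Ω : Type*} {d : ℕ} (B : ℝ≥0 → Ω → EuclideanSpace ℝ (Fin d))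
    (k : Fin d → ℕ) (ε : ℝ)
    (ω : Ω) (q : ℝ × ℝ) : ‖dsltIntegrand B k ε 0 ω q‖ ≤ kernelBound k ε :=
  norm_gaussianKernelDeriv_le k ε _

lemma ofReal_re_dsltApprox {Ω : Type*} {d : ℕ} (B : ℝ≥0 → Ω → EuclideanSpace ℝ (Fin d))
    (k : Fin d → ℕ) (t ε : ℝ)
    (ω : Ω) : (((dsltApprox B k t ε 0 ω).re : ℝ) : ℂ) = dsltApprox B k t ε 0 ω := by
  rw [← Complex.conj_eq_iff_re]
  unfold dsltApprox
  rw [map_mul, map_pow, map_neg, map_one, ← integral_conj]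
  congr 1
  refine integral_congr_ae (ae_of_all _ fun q => ?_)
  exact conj_gaussianKernelDeriv k ε _

section Approximation

variable {Ω : Type*} [MeasurableSpace Ω] {P : Measure Ω} [IsProbabilityMeasure P] {d : ℕ}
  {B : ℝ≥0 → Ω → EuclideanSpace ℝ (Fin d)}

lemma aestronglyMeasurable_dsltIntegrand
    (hBm : AEMeasurable (fun q : ℝ × Ω => B q.1.toNNReal q.2) ((volume : Measure ℝ).prod P))
    (k : Fin d → ℕ) (ε : ℝ) (S : Set (ℝ × ℝ)) :
    AEStronglyMeasurable (fun z : Ω × (ℝ × ℝ) => dsltIntegrand B k ε 0 z.1 z.2)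
      (P.prod (volume.restrict S)) := by
  have q1 : Measure.QuasiMeasurePreserving (fun z : Ω × (ℝ × ℝ) => (z.2.1, z.1))
      (P.prod volume) ((volume : Measure ℝ).prod P) :=
    (QuasiMeasurePreserving.prodMap
      (Measure.quasiMeasurePreserving_fst (μ := (volume : Measure ℝ)) (ν := (volume : Measure ℝ)))
      (Measure.QuasiMeasurePreserving.id P)).comp
      (Measure.measurePreserving_swap (μ := P) (ν := volume)).quasiMeasurePreserving
  have q2 : Measure.QuasiMeasurePreserving (fun z : Ω × (ℝ × ℝ) => (z.2.2, z.1))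
      (P.prod volume) ((volume : Measure ℝ).prod P) :=
    (QuasiMeasurePreserving.prodMap
      (Measure.quasiMeasurePreserving_snd (μ := (volume : Measure ℝ)) (ν := (volume : Measure ℝ)))
      (Measure.QuasiMeasurePreserving.id P)).comp
      (Measure.measurePreserving_swap (μ := P) (ν := volume)).quasiMeasurePreserving
  have h1 := hBm.comp_quasiMeasurePreserving q1
  have h2 := hBm.comp_quasiMeasurePreserving q2
  have h3 : AEMeasurable (fun z : Ω × (ℝ × ℝ) => dsltIntegrand B k ε 0 z.1 z.2)
      (P.prod volume) :=
    (measurable_gaussianKernelDeriv k ε).comp_aemeasurable ((h2.sub h1).sub_const 0)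
  refine (h3.mono_ac ?_).aestronglyMeasurable
  exact Measure.AbsolutelyContinuous.prod Measure.AbsolutelyContinuous.rfl
    Measure.absolutelyContinuous_restrict

lemma ae_integrableOn_dsltIntegrand
    (hBm : AEMeasurable (fun q : ℝ × Ω => B q.1.toNNReal q.2) ((volume : Measure ℝ).prod P))
    (k : Fin d → ℕ) (t ε : ℝ) :
    ∀ᵐ ω ∂P, IntegrableOn (dsltIntegrand B k ε 0 ω) (timeSimplex t) := by
  filter_upwards [(aestronglyMeasurable_dsltIntegrand hBm k ε (timeSimplex t)).prodMk_left]
    with ω hω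
  have : IsFiniteMeasure (volume.restrict (timeSimplex t)) :=
    ⟨by rw [Measure.restrict_apply_univ]; exact volume_timeSimplex_lt_top t⟩
  exact Integrable.of_bound hω (kernelBound k ε) (ae_of_all _ (norm_dsltIntegrand_le B k ε ω))

lemma memLp_dsltApprox
    (hBm : AEMeasurable (fun q : ℝ × Ω => B q.1.toNNReal q.2) ((volume : Measure ℝ).prod P))
    (k : Fin d → ℕ) (t ε : ℝ) : MemLp (dsltApprox B k t ε 0) 2 P := by
  have : IsFiniteMeasure (volume.restrict (timeSimplex t)) :=
    ⟨by rw [Measure.restrict_apply_univ]; exact volume_timeSimplex_lt_top t⟩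
  refine MemLp.of_bound
    ((aestronglyMeasurable_dsltIntegrand hBm k ε (timeSimplex t)).integral_prod_right'.const_mul _)
    (kernelBound k ε * volume.real (timeSimplex t)) (ae_of_all _ fun ω => ?_)
  unfold dsltApprox
  rw [norm_mul, norm_pow, norm_neg, norm_one, one_pow, one_mul]
  exact norm_setIntegral_le_of_norm_le_const (volume_timeSimplex_lt_top t)
    fun q _ => norm_dsltIntegrand_le B k ε ω q

/-- Fubini's theorem for the product of two approximations. -/
lemma integral_dsltApprox_mul
    (hBm : AEMeasurable (fun q : ℝ × Ω => B q.1.toNNReal q.2) ((volume : Measure ℝ).prod P))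
    (k : Fin d → ℕ) (t ε η : ℝ) :
    ∫ ω, dsltApprox B k t ε 0 ω * dsltApprox B k t η 0 ω ∂P
      = ∫ z in timeSimplex t ×ˢ timeSimplex t,
        ∫ ω, dsltIntegrand B k ε 0 ω z.1 * dsltIntegrand B k η 0 ω z.2 ∂P := by
  have : IsFiniteMeasure (volume.restrict (timeSimplex t)) :=
    ⟨by rw [Measure.restrict_apply_univ]; exact volume_timeSimplex_lt_top t⟩
  set V := (volume : Measure (ℝ × ℝ)).restrict (timeSimplex t) with hV
  have hVV : (volume : Measure ((ℝ × ℝ) × (ℝ × ℝ))).restrict (timeSimplex t ×ˢ timeSimplex t)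
      = V.prod V := by
    rw [Measure.volume_eq_prod, Measure.prod_restrict]
  rw [hVV]
  have e1 : ∀ ω, dsltApprox B k t ε 0 ω * dsltApprox B k t η 0 ω
      = ∫ z, dsltIntegrand B k ε 0 ω z.1 * dsltIntegrand B k η 0 ω z.2 ∂(V.prod V) := by
    intro ω
    rw [integral_prod_mul]
    unfold dsltApprox
    rw [mul_mul_mul_comm, ← mul_pow]
    simp [hV]
  simp_rw [e1]
  refine integral_integral_swap (Integrable.of_bound (C := kernelBound k ε * kernelBound k η) ?_
    (ae_of_all _ fun z => ?_))
  · exact (aestronglyMeasurable_dsltIntegrand hBm k ε (timeSimplex t)).mul_fst_snd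
      (aestronglyMeasurable_dsltIntegrand hBm k η (timeSimplex t))
  · simp only [Function.uncurry, norm_mul]
    exact mul_le_mul (norm_dsltIntegrand_le B k ε _ _) (norm_dsltIntegrand_le B k η _ _)
      (norm_nonneg _) ((norm_nonneg _).trans (norm_dsltIntegrand_le B k ε z.1 z.2.1))

/-- The product over the coordinates of the mixed moments of the increments over `[r, s]` and
`[u, v]`, with variances shifted by `ε` and `η`. -/
noncomputable def incrementMoment {d : ℕ} (H : ℝ) (k : Fin d → ℕ) (ε η : ℝ)
    (z : (ℝ × ℝ) × (ℝ × ℝ)) : ℝ :=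
  ∏ i, mixedMoment (k i) (incCov H z.1.1 z.1.2 z.2.1 z.2.2)
    ((|z.1.2 - z.1.1| ^ (2 * H) + ε) * (|z.2.2 - z.2.1| ^ (2 * H) + η)
      - incCov H z.1.1 z.1.2 z.2.1 z.2.2 ^ 2)

lemma IsFractionalBrownianMotion.integral_dsltIntegrand_mul {H : ℝ} (h0 : 0 < H) (h1 : H < 1)
    (hB : IsFractionalBrownianMotion H B P) (k : Fin d → ℕ) {t ε η : ℝ} (hε : 0 < ε) (hη : 0 < η)
    {z : (ℝ × ℝ) × (ℝ × ℝ)} (hz : z ∈ timeSimplex t ×ˢ timeSimplex t) :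
    ∫ ω, dsltIntegrand B k ε 0 ω z.1 * dsltIntegrand B k η 0 ω z.2 ∂P
      = (Complex.I ^ multiOrder k / ((2 * Real.pi : ℝ) : ℂ) ^ d) ^ 2 *
        ((incrementMoment H k ε η z : ℝ) : ℂ) := by
  obtain ⟨⟨hr, hrs, -⟩, ⟨hu, huv, -⟩⟩ := hz
  have er := Real.coe_toNNReal _ hr.le
  have es := Real.coe_toNNReal _ (hr.trans hrs).le
  have eu := Real.coe_toNNReal _ hu.le
  have ev := Real.coe_toNNReal _ (hu.trans huv).le
  have hchar := hB.integral_exp_pairing h0 z.1.1.toNNReal z.1.2.toNNReal z.2.1.toNNReal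
    z.2.2.toNNReal
  rw [er, es, eu, ev] at hchar
  have hm : ∀ s : ℝ≥0, AEMeasurable (B s) P := fun s => hB.isGaussianProcess.aemeasurable s
  unfold dsltIntegrand incrementMoment
  simp only [sub_zero]
  exact integral_gaussianKernelDeriv_mul ((hm _).sub (hm _)) ((hm _).sub (hm _))
    (by positivity) (by positivity) (sq_incCov_le h0 h1 _ _ _ _) hchar k hε hη

end Approximation

/-! ### Convergence of the second moments -/

lemma multiOrder_eq {d : ℕ} (k : Fin d → ℕ) : multiOrder k = 2 * (∑ i, k i / 2) + ∑ i, k i % 2 := by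
  unfold multiOrder
  rw [Finset.mul_sum, ← Finset.sum_add_distrib]
  exact Finset.sum_congr rfl fun i _ => by omega

lemma oddCount_eq {d : ℕ} (k : Fin d → ℕ) : oddCount k = ∑ i, k i % 2 := by
  unfold oddCount
  rw [Finset.card_filter]
  refine Finset.sum_congr rfl fun i _ => ?_
  split_ifs with h
  · exact (Nat.odd_iff.1 h).symm
  · exact (Nat.even_iff.1 (Nat.not_odd_iff_even.1 h)).symm

/-- The shifts `ε` and `η` only enlarge the determinant, so one bound serves all of them. -/
lemma abs_incrementMoment_le {d : ℕ} {H : ℝ} (h0 : 0 < H) (h1 : H < 1) (k : Fin d → ℕ) {ε η : ℝ}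
    (hε : 0 ≤ ε) (hη : 0 ≤ η) {z : (ℝ × ℝ) × (ℝ × ℝ)}
    (hz : 0 < gramDet H z.1.1 z.1.2 z.2.1 z.2.2) :
    |incrementMoment H k ε η z| ≤ (∏ i, mixedMomentConst (k i)) *
      gramMajorant H (∑ i, k i / 2) (∑ i, k i % 2)
        (2 * (∑ i, k i / 2 : ℕ) + (∑ i, k i % 2 : ℕ) + (d : ℝ) / 2) z.1.1 z.1.2 z.2.1 z.2.2 := by
  set D₀ := gramDet H z.1.1 z.1.2 z.2.1 z.2.2 with hD₀
  set m := incCov H z.1.1 z.1.2 z.2.1 z.2.2 with hm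
  set L := |z.1.2 - z.1.1| ^ (2 * H) * |z.2.2 - z.2.1| ^ (2 * H) with hL
  have hDL : D₀ = L - m ^ 2 := rfl
  have hl : 0 ≤ |z.1.2 - z.1.1| ^ (2 * H) := by positivity
  have hr : 0 ≤ |z.2.2 - z.2.1| ^ (2 * H) := by positivity
  have e : gramMajorant H (∑ i, k i / 2) (∑ i, k i % 2)
        (2 * (∑ i, k i / 2 : ℕ) + (∑ i, k i % 2 : ℕ) + (d : ℝ) / 2) z.1.1 z.1.2 z.2.1 z.2.2
      = ∏ i, (|m| ^ (k i % 2) * L ^ (k i / 2) * D₀ ^ (-(k i + 1 / 2 : ℝ))) := by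
    rw [Finset.prod_mul_distrib, Finset.prod_mul_distrib, Finset.prod_pow_eq_pow_sum,
      Finset.prod_pow_eq_pow_sum, ← Real.rpow_sum_of_pos hz]
    unfold gramMajorant
    congr 2
    have h2 : (2 * (∑ i, k i / 2 : ℕ) + (∑ i, k i % 2 : ℕ) : ℝ) = ∑ i, (k i : ℝ) := by
      have h3 := multiOrder_eq k
      unfold multiOrder at h3
      exact_mod_cast h3.symm
    rw [h2, Finset.sum_neg_distrib, Finset.sum_add_distrib]
    simp
    ring
  rw [e, ← Finset.prod_mul_distrib]
  unfold incrementMoment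
  rw [Finset.abs_prod]
  refine Finset.prod_le_prod (fun _ _ => abs_nonneg _) fun i _ => ?_
  refine abs_mixedMoment_le (k i) hz ?_ (sq_incCov_le h0 h1 _ _ _ _) ?_
  · rw [hDL, hL]
    nlinarith [mul_nonneg hl hη, mul_nonneg hε hr, mul_nonneg hε hη]
  · rw [hDL]; nlinarith [sq_nonneg m]

lemma measurable_incrementMoment {d : ℕ} (H : ℝ) (k : Fin d → ℕ) (ε η : ℝ) :
    Measurable (incrementMoment H k ε η) := by
  unfold incrementMoment mixedMoment incCov
  fun_prop

lemma tendsto_incrementMoment {d : ℕ} (H : ℝ) (k : Fin d → ℕ) {z : (ℝ × ℝ) × (ℝ × ℝ)}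
    (hz : 0 < gramDet H z.1.1 z.1.2 z.2.1 z.2.2) :
    Tendsto (fun x : ℝ × ℝ => incrementMoment H k x.1 x.2 z) (𝓝 (0, 0))
      (𝓝 (incrementMoment H k 0 0 z)) := by
  unfold incrementMoment
  refine tendsto_finsetProd _ fun i _ => ?_
  have hc : Tendsto (fun x : ℝ × ℝ => (|z.1.2 - z.1.1| ^ (2 * H) + x.1) *
      (|z.2.2 - z.2.1| ^ (2 * H) + x.2) - incCov H z.1.1 z.1.2 z.2.1 z.2.2 ^ 2) (𝓝 (0, 0))
      (𝓝 ((|z.1.2 - z.1.1| ^ (2 * H) + 0) *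
      (|z.2.2 - z.2.1| ^ (2 * H) + 0) - incCov H z.1.1 z.1.2 z.2.1 z.2.2 ^ 2)) := by
    have : Continuous fun x : ℝ × ℝ => (|z.1.2 - z.1.1| ^ (2 * H) + x.1) *
      (|z.2.2 - z.2.1| ^ (2 * H) + x.2) - incCov H z.1.1 z.1.2 z.2.1 z.2.2 ^ 2 := by fun_prop
    exact this.tendsto (0, 0)
  exact (continuousAt_mixedMoment (k i) _ (by simpa [gramDet] using hz)).tendsto.comp hc

/-- The second moments converge by dominated convergence. -/
lemma tendsto_integral_incrementMoment {d : ℕ} {H : ℝ} (h0 : 0 < H) (h1 : H < 1)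
    (k : Fin d → ℕ) {t : ℝ}
    (hint : IntegrableOn (fun p : (ℝ × ℝ) × (ℝ × ℝ) =>
      gramMajorant H (∑ i, k i / 2) (∑ i, k i % 2)
        (2 * (∑ i, k i / 2 : ℕ) + (∑ i, k i % 2 : ℕ) + (d : ℝ) / 2) p.1.1 p.1.2 p.2.1 p.2.2)
      (timeSimplex t ×ˢ timeSimplex t)) :
    Tendsto (fun x : ℝ × ℝ => ∫ z in timeSimplex t ×ˢ timeSimplex t, incrementMoment H k x.1 x.2 z)
      (𝓝[>] 0 ×ˢ 𝓝[>] 0)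
      (𝓝 (∫ z in timeSimplex t ×ˢ timeSimplex t, incrementMoment H k 0 0 z)) := by
  have hpos : ∀ᵐ z ∂((volume : Measure ((ℝ × ℝ) × (ℝ × ℝ))).restrict
      (timeSimplex t ×ˢ timeSimplex t)), 0 < gramDet H z.1.1 z.1.2 z.2.1 z.2.2 := by
    filter_upwards [ae_restrict_mem ((measurableSet_timeSimplex t).prod
      (measurableSet_timeSimplex t)), ae_restrict_of_ae ae_times_ne] with z hz hne
    exact gramDet_pos h0 h1 hz.1.2.1 hz.2.2.1 hne.2.2.2
  refine tendsto_integral_filter_of_dominated_convergence _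
    (Eventually.of_forall fun x => (measurable_incrementMoment H k _ _).aestronglyMeasurable) ?_
    (hint.const_mul (∏ i, mixedMomentConst (k i))) ?_
  · filter_upwards [prod_mem_prod (self_mem_nhdsWithin (a := (0 : ℝ)) (s := Set.Ioi 0))
      (self_mem_nhdsWithin (a := (0 : ℝ)) (s := Set.Ioi 0))] with x hx
    filter_upwards [hpos] with z hz
    exact abs_incrementMoment_le h0 h1 k (le_of_lt hx.1) (le_of_lt hx.2) hz
  · filter_upwards [hpos] with z hz
    refine (tendsto_incrementMoment H k hz).mono_left ?_
    rw [nhds_prod_eq]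
    exact prod_mono nhdsWithin_le_nhds nhdsWithin_le_nhds

/-- The hypothesis on the Hurst parameter, in the form used by `integrableOn_gramMajorant`. -/
lemma hurst_conditions {d : ℕ} (hd : 0 < d) {H : ℝ} (k : Fin d → ℕ)
    (hH : H < min (2 / (2 * (multiOrder k : ℝ) + d))
      (min (1 / ((multiOrder k : ℝ) + d - oddCount k)) (1 / (d : ℝ)))) :
    H * (2 * (2 * (∑ i, k i / 2 : ℕ) + (∑ i, k i % 2 : ℕ)) + d) < 2 ∧ H * d < 1 ∧
      H * (2 * (∑ i, k i / 2 : ℕ) + 2 * (∑ i, k i % 2 : ℕ) + d)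
        - (∑ i, k i % 2 : ℕ) * min (2 * H) 1 < 1 := by
  rw [oddCount_eq, multiOrder_eq] at hH
  generalize (∑ i, k i / 2) = N at hH ⊢
  generalize (∑ i, k i % 2) = n at hH ⊢
  have hd' : (1 : ℝ) ≤ d := by exact_mod_cast hd
  have hN : (0 : ℝ) ≤ N := by positivity
  have hn : (0 : ℝ) ≤ n := by positivity
  push_cast at hH
  obtain ⟨hA, hBC⟩ := lt_min_iff.1 hH
  obtain ⟨hC, hB⟩ := lt_min_iff.1 hBC
  rw [lt_div_iff₀ (by positivity)] at hA hB
  rw [lt_div_iff₀ (by linarith)] at hC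
  refine ⟨hA, hB, ?_⟩
  rcases le_or_gt (2 * H) 1 with h | h
  · rw [min_eq_left h]; linarith
  · -- `H > 1/2` forces `d = 1` and `|k| ≤ 1`
    rw [min_eq_right h.le]
    have hd1 : d = 1 := by
      have : (d : ℝ) < 2 := by nlinarith
      have : d < 2 := by exact_mod_cast this
      omega
    subst hd1
    have h4 : (2 * (2 * N + n) + 1 : ℝ) < 4 := by push_cast at hA; nlinarith
    have h5 : 2 * (2 * N + n) + 1 < 4 := by exact_mod_cast h4
    have hN0 : N = 0 := by omega
    have hn1 : n = 0 ∨ n = 1 := by omega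
    subst hN0
    push_cast at *
    rcases hn1 with rfl | rfl <;> push_cast at * <;> linarith

theorem theorem1p1 {Ω : Type*} [MeasurableSpace Ω] (P : Measure Ω) [IsProbabilityMeasure P]
    (d : ℕ) (hd : 0 < d) (H : ℝ) (hH0 : 0 < H) (hH1 : H < 1)
    (B : ℝ≥0 → Ω → EuclideanSpace ℝ (Fin d)) (hB : IsFractionalBrownianMotion H B P)
    (hBm : AEMeasurable (fun q : ℝ × Ω => B q.1.toNNReal q.2) ((volume : Measure ℝ).prod P))
    (k : Fin d → ℕ) (t : ℝ) (ht : 0 ≤ t)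
    (hH : H < min (2 / (2 * (multiOrder k : ℝ) + d))
      (min (1 / ((multiOrder k : ℝ) + d - oddCount k)) (1 / (d : ℝ)))) :
    (∀ ε : ℝ, 0 < ε →
      (∀ᵐ ω ∂P, IntegrableOn (dsltIntegrand B k ε 0 ω) (timeSimplex t)) ∧
      MemLp (dsltApprox B k t ε 0) 2 P) ∧
    ∃ α : Ω → ℝ, MemLp α 2 P ∧
      Tendsto (fun ε : ℝ => eLpNorm (fun ω => dsltApprox B k t ε 0 ω - ((α ω : ℝ) : ℂ)) 2 P)
        (𝓝[>] 0) (𝓝 0) := by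
  refine ⟨fun ε _ => ⟨ae_integrableOn_dsltIntegrand hBm k t ε, memLp_dsltApprox hBm k t ε⟩, ?_⟩
  obtain ⟨hA, hB', hC⟩ := hurst_conditions hd k hH
  have hlim := tendsto_integral_incrementMoment hH0 hH1 k
    (integrableOn_gramMajorant hH0 hH1 (Nat.cast_nonneg d) ht hA hB' hC)
  set c : ℂ := (Complex.I ^ multiOrder k / ((2 * Real.pi : ℝ) : ℂ) ^ d) ^ 2 with hc
  have hmul : Tendsto (fun x : ℝ × ℝ =>
      ∫ ω, (dsltApprox B k t x.1 0 ω).re * (dsltApprox B k t x.2 0 ω).re ∂P)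
      (𝓝[>] 0 ×ˢ 𝓝[>] 0)
      (𝓝 (c.re * ∫ z in timeSimplex t ×ˢ timeSimplex t, incrementMoment H k 0 0 z)) := by
    refine (hlim.const_mul c.re).congr' ?_
    filter_upwards [prod_mem_prod (self_mem_nhdsWithin (a := (0 : ℝ)) (s := Set.Ioi 0))
      (self_mem_nhdsWithin (a := (0 : ℝ)) (s := Set.Ioi 0))] with x hx
    have e1 : ((∫ ω, (dsltApprox B k t x.1 0 ω).re * (dsltApprox B k t x.2 0 ω).re ∂P : ℝ) : ℂ)
        = c * ((∫ z in timeSimplex t ×ˢ timeSimplex t, incrementMoment H k x.1 x.2 z : ℝ) : ℂ) := by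
      rw [← integral_complex_ofReal]
      simp only [Complex.ofReal_mul, ofReal_re_dsltApprox]
      rw [integral_dsltApprox_mul hBm, ← integral_complex_ofReal, ← integral_const_mul]
      exact setIntegral_congr_fun ((measurableSet_timeSimplex t).prod (measurableSet_timeSimplex t))
        fun z hz => hB.integral_dsltIntegrand_mul hH0 hH1 k hx.1 hx.2 hz
    have e2 := congrArg Complex.re e1
    rw [Complex.ofReal_re, Complex.re_mul_ofReal] at e2
    exact e2.symm
  obtain ⟨α, hα, hα'⟩ := exists_tendsto_eLpNorm_of_tendsto_integral_mul
    (A := fun ε ω => (dsltApprox B k t ε 0 ω).re)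
    (Eventually.of_forall fun ε => (memLp_dsltApprox hBm k t ε).re) hmul
  refine ⟨α, hα, hα'.congr fun ε => ?_⟩
  refine eLpNorm_congr_norm_ae (ae_of_all _ fun ω => ?_)
  rw [← ofReal_re_dsltApprox, ← Complex.ofReal_sub, Complex.norm_real, Complex.ofReal_re]
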